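/- **Setting.** Let $\mathcal U,\mathcal V,\mathcal X$ be finite-dimensional real inner product spaces, and let $\mathcal U\times\mathcal V$ and $\mathcal U\times\mathcal V\times\mathcal X$ carry the product inner products. Let $\mathcal A:\mathcal X\to\mathcal U$, $\mathcal B:\mathcal X\to\mathcal V$ be linear and $c\in\mathcal X$. Consider $$\min_{u,v}\ \theta(u,v):=p(u)+q(v)+\phi(u,v)\quad\text{s.t.}\quad \mathcal A^*u+\mathcal B^*v=c,$$ where $p:\mathcal U\to(-\infty,\infty]$ and $q:\mathcal V\to(-\infty,\infty]$ are closed proper convex functions and $\phi:\mathcal U\times\mathcal V\to\mathbb R$ is a differentiable convex function with Lipschitz continuous gradient. Write $w=(u,v)$, $\|z\|_G^2=\langle z,Gz\rangle$, and let $\partial^2\phi(w)$ be Clarke's generalized Hessian, i.e. the convex hull of all limits $\lim_j\nabla^2\phi(w_j)$ with $w_j\to w$ and $\nabla^2\phi(w_j)$ existing. Let $\mathcal Q$ on $\mathcal U\times\mathcal V$ (with blocks $\mathcal Q_{11},\mathcal Q_{12},\mathcal Q_{22}$), $\mathcal D_1,\mathcal S$ on $\mathcal U$ and $\mathcal D_2,\mathcal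 T$ on $\mathcal V$ be self-adjoint positive semidefinite operators, put $\mathcal H=\mathrm{Diag}(\mathcal D_1,\mathcal D_2)$, and let $\eta\in[0,1]$, such that for all $\mathcal W\in\partial^2\phi(w)$ at any point $w\in\mathcal U\times\mathcal V$ and all $u\in\mathcal U$, $v\in\mathcal V$, $$\mathcal Q\preceq\mathcal W\preceq\mathcal Q+\mathcal H,\qquad |\langle u,(\mathcal W_{12}-\mathcal Q_{12})v\rangle|\le\tfrac{\eta}{2}\big(\|u\|_{\mathcal D_1}^2+\|v\|_{\mathcal D_2}^2\big).$$ Assume that the problem has an optimal solution and that some $(\hat u,\hat v)\in\mathrm{ri}(\mathrm{dom}\,p\times\mathrm{dom}\,q)$ satisfies $\mathcal A^*\hat u+\mathcal B^*\hat v=c$. **Algorithm (majorized ADMM).** Let $\sigma,\tau>0$ and $$\hat\phi(w;w')=\phi(w')+\langle\nabla\phi(w'),w-w'\rangle+\tfrac12\|w'-w\|^2_{\mathcal Q+\mathcal H},$$ $$\widehat{\mathcal L}_\sigma(w;(x,w'))=p(u)+q(v)+\hat\phi(w;w')+\langle x,\mathcal A^*u+\mathcal B^*v-c\rangle+\tfrac{\sigma}{2}\|\mathcal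 A^*u+\mathcal B^*v-c\|^2 .$$ From $(u^0,v^0,x^0)\in\mathrm{dom}\,p\times\mathrm{dom}\,q\times\mathcal X$, for $k=0,1,\dots$, $$u^{k+1}\in\arg\min_u\{\widehat{\mathcal L}_\sigma(u,v^k;(x^k,w^k))+\tfrac12\|u-u^k\|_{\mathcal S}^2\},\qquad v^{k+1}\in\arg\min_v\{\widehat{\mathcal L}_\sigma(u^{k+1},v;(x^k,w^k))+\tfrac12\|v-v^k\|_{\mathcal T}^2\},$$ $$x^{k+1}=x^k+\tau\sigma(\mathcal A^*u^{k+1}+\mathcal B^*v^{k+1}-c).$$ Let $\tilde x^{k+1}=x^k+\sigma(\mathcal A^*u^{k+1}+\mathcal B^*v^{k+1}-c)$ and, for $k\ge1$, $$\hat x^k=\frac1k\sum_{i=1}^k\tilde x^{i+1},\quad \hat u^k=\frac1k\sum_{i=1}^k u^{i+1},\quad \hat v^k=\frac1k\sum_{i=1}^k v^{i+1},\quad \hat w^k=(\hat u^k,\hat v^k).$$ **Convergence conditions.** Assume $\mathcal Q_{11}+\sigma\mathcal A\mathcal A^*+\mathcal S\succ0$, $\mathcal Q_{22}+\sigma\mathcal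 B\mathcal B^*+\mathcal T\succ0$, and one of the following. (a) $\tau\in(0,1]$ and, for all $w=(u,v)$, $\langle w,[\mathcal Q+\mathrm{Diag}(\mathcal S+(1-\tau)\sigma\mathcal A\mathcal A^*,\ \mathcal T+(1-\tau)\sigma\mathcal B\mathcal B^*)]w\rangle=0\Rightarrow\|u\|\,\|v\|=0$. (b) $\tau\in(0,\frac{1+\sqrt5}{2})$, $\mathcal M:=\frac14\mathcal Q+\mathrm{Diag}(\mathcal S-\eta\mathcal D_1,\mathcal T-\eta\mathcal D_2)\succeq0$, $\frac14\mathcal Q_{11}+\mathcal S+\sigma\mathcal A\mathcal A^*-\eta\mathcal D_1\succ0$, $\frac14\mathcal Q_{22}+\mathcal T+\sigma\mathcal B\mathcal B^*-\eta\mathcal D_2\succ0$ and, for all $w=(u,v)$, $\langle w,[\mathcal M+\sigma\,\mathrm{Diag}(\mathcal A\mathcal A^*,\mathcal B\mathcal B^*)]w\rangle=0\Rightarrow\|u\|\,\|v\|=0$. **Theorem.** There are constants $D_1,D_2,D_3$ such that, for every $k\ge1$: (i) $\|\mathcal A^*\hat u^k+\mathcal B^*\hat v^k-c\|\le D_1/k$.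 (ii) $(\hat u^k,\hat v^k,\hat x^k)$ is a $(D_2/k)$-approximate solution: for all $(u,v,x)$ with $\|(u,v,x)-(\hat u^k,\hat v^k,\hat x^k)\|\le1$, $$(p(\hat u^k)+q(\hat v^k))-(p(u)+q(v))+\langle\hat w^k-w,\nabla\phi(w)\rangle+\langle\hat u^k-u,\mathcal Ax\rangle+\langle\hat v^k-v,\mathcal Bx\rangle-\langle\hat x^k-x,\mathcal A^*u+\mathcal B^*v-c\rangle\le D_2/k .$$ (iii) In case (a), and also in case (b) if in addition $\mathcal S-\eta\mathcal D_1\succeq0$ and $\mathcal T-\eta\mathcal D_2\succeq0$, every optimal solution $(\bar u,\bar v)$ satisfies $|\theta(\hat u^k,\hat v^k)-\theta(\bar u,\bar v)|\le D_3/k$. For fixed $\mathcal A,\mathcal B,c,\mathcal Q,\mathcal D_1,\mathcal D_2,\eta,\mathcal S,\mathcal T,\sigma,\tau$, the constants $D_1,D_2,D_3$ depend only on the initial point $(u^0,v^0,x^0)$ and on the set of optimal solutions with their multipliers, i.e. of all $(\bar u,\bar v,\bar x)$ with $0\in\nabla\phi(\bar u,\bar v)+(\partial p(\bar u)+\mathcal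 A\bar x,\ \partial q(\bar v)+\mathcal B\bar x)$ and $\mathcal A^*\bar u+\mathcal B^*\bar v=c$; they depend on $p,q,\phi$ only through this set. -/

import Mathlib

open Filter Topology Set

namespace MajADMM

noncomputable section

/-! ### Operators on Euclidean spaces -/

section Operators

variable {E : Type*} [NormedAddCommGroup E] [InnerProductSpace ℝ E]
variable {U : Type*} [NormedAddCommGroup U] [InnerProductSpace ℝ U]
variable {V : Type*} [NormedAddCommGroup V] [InnerProductSpace ℝ V]

/-- A self-adjoint positive definite operator. (Positive semidefinite operators are
`ContinuousLinearMap.IsPositive`, which includes self-adjointness.) -/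
def IsPosDef (M : E →L[ℝ] E) : Prop :=
  (M : E →ₗ[ℝ] E).IsSymmetric ∧ ∀ x : E, x ≠ 0 → 0 < inner ℝ x (M x)

/-- `‖x‖²_G = ⟨x, G x⟩`. -/
def sqNorm (G : E →L[ℝ] E) (x : E) : ℝ := inner ℝ x (G x)

/-- The point `(u, v)` of the Euclidean product `U × V`. -/
abbrev pair (u : U) (v : V) : WithLp 2 (U × V) := WithLp.toLp 2 (u, v)

/-- The embedding `u ↦ (u, 0)`. -/
def inlL : U →L[ℝ] WithLp 2 (U × V) :=
  ((WithLp.prodContinuousLinearEquiv 2 ℝ U V).symm : U × V →L[ℝ] WithLp 2 (U × V)).comp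
    (ContinuousLinearMap.inl ℝ U V)

/-- The embedding `v ↦ (0, v)`. -/
def inrL : V →L[ℝ] WithLp 2 (U × V) :=
  ((WithLp.prodContinuousLinearEquiv 2 ℝ U V).symm : U × V →L[ℝ] WithLp 2 (U × V)).comp
    (ContinuousLinearMap.inr ℝ U V)

/-- The projection onto the first factor. -/
def projU : WithLp 2 (U × V) →L[ℝ] U := WithLp.fstL 2 ℝ U V

/-- The projection onto the second factor. -/
def projV : WithLp 2 (U × V) →L[ℝ] V := WithLp.sndL 2 ℝ U V

/-- The block `M₁₁ : U → U`. -/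
def block11 (M : WithLp 2 (U × V) →L[ℝ] WithLp 2 (U × V)) : U →L[ℝ] U :=
  projU.comp (M.comp inlL)

/-- The block `M₁₂ : V → U`. -/
def block12 (M : WithLp 2 (U × V) →L[ℝ] WithLp 2 (U × V)) : V →L[ℝ] U :=
  projU.comp (M.comp inrL)

/-- The block `M₂₂ : V → V`. -/
def block22 (M : WithLp 2 (U × V) →L[ℝ] WithLp 2 (U × V)) : V →L[ℝ] V :=
  projV.comp (M.comp inrL)

/-- The block diagonal operator `Diag(G₁, G₂)`, that is `(u, v) ↦ (G₁ u, G₂ v)`. -/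
def diag (G₁ : U →L[ℝ] U) (G₂ : V →L[ℝ] V) : WithLp 2 (U × V) →L[ℝ] WithLp 2 (U × V) :=
  inlL.comp (G₁.comp projU) + inrL.comp (G₂.comp projV)

end Operators

/-! ### Convex functions and generalized Hessians -/

section Convex

variable {E : Type*} [NormedAddCommGroup E] [InnerProductSpace ℝ E]

/-- A closed proper convex function with values in `(-∞, ∞]`. -/
structure IsClosedProperConvex (f : E → EReal) : Prop where
  ne_bot : ∀ x, f x ≠ ⊥
  exists_ne_top : ∃ x, f x ≠ ⊤
  lsc : LowerSemicontinuous f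
  convex_epigraph : Convex ℝ {z : E × ℝ | f z.1 ≤ (z.2 : EReal)}

/-- The effective domain. -/
def dom (f : E → EReal) : Set E := {x | f x ≠ ⊤}

/-- The subdifferential `∂f(x)` of convex analysis (for proper `f` it is empty off `dom f`). -/
def subdiff (f : E → EReal) (x : E) : Set E :=
  {ξ | ∀ y, f x + ((inner ℝ ξ (y - x) : ℝ) : EReal) ≤ f y}

variable [FiniteDimensional ℝ E]

/-- Clarke's generalized Hessian: the convex hull of all limits of Hessians `∇²φ(wᵏ)` along
sequences `wᵏ → w` of points at which the Hessian exists. -/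
def genHessian (φ : E → ℝ) (w : E) : Set (E →L[ℝ] E) :=
  convexHull ℝ {M | ∃ s : ℕ → E, Tendsto s atTop (𝓝 w) ∧
    (∀ k, DifferentiableAt ℝ (gradient φ) (s k)) ∧
    Tendsto (fun k => fderiv ℝ (gradient φ) (s k)) atTop (𝓝 M)}

/-- A differentiable convex function with a globally Lipschitz continuous gradient. -/
structure IsSmoothConvex (φ : E → ℝ) : Prop where
  convex : ConvexOn ℝ univ φ
  differentiable : Differentiable ℝ φ
  lipschitz_gradient : ∃ L : NNReal, LipschitzWith L (gradient φ)

end Convex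

/-! ### The problem, the algorithm and its parameters -/

section Problem

variable (U V X : Type*)
variable [NormedAddCommGroup U] [InnerProductSpace ℝ U]
variable [NormedAddCommGroup V] [InnerProductSpace ℝ V]
variable [NormedAddCommGroup X] [InnerProductSpace ℝ X]

/-- The constraint `A* u + B* v = c`, the operators `Q, D₁, D₂` and the number `η` in the bounds
on the generalized Hessian of `φ`, the proximal operators `S, T`, the penalty parameter `σ` and
the step length `τ`. -/
structure Data where
  A : X →L[ℝ] U
  B : X →L[ℝ] V
  c : X
  Q : WithLp 2 (U × V) →L[ℝ] WithLp 2 (U × V)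
  D₁ : U →L[ℝ] U
  D₂ : V →L[ℝ] V
  η : ℝ
  S : U →L[ℝ] U
  T : V →L[ℝ] V
  σ : ℝ
  τ : ℝ

/-- The three parts of the objective `θ(u, v) = p(u) + q(v) + φ(u, v)`. -/
structure Objective where
  p : U → EReal
  q : V → EReal
  φ : WithLp 2 (U × V) → ℝ

variable {U V X}

/-- The objective function `θ`. -/
def Objective.θ (P : Objective U V) (u : U) (v : V) : EReal :=
  P.p u + P.q v + ((P.φ (pair u v) : ℝ) : EReal)

variable [FiniteDimensional ℝ U] [FiniteDimensional ℝ V] [FiniteDimensional ℝ X]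

namespace Data

variable (d : Data U V X)

/-- The sign and range conditions on the parameters. -/
structure Admissible : Prop where
  Q_pos : d.Q.IsPositive
  D₁_pos : d.D₁.IsPositive
  D₂_pos : d.D₂.IsPositive
  S_pos : d.S.IsPositive
  T_pos : d.T.IsPositive
  η_mem : d.η ∈ Icc (0 : ℝ) 1
  σ_pos : 0 < d.σ
  τ_pos : 0 < d.τ

/-- The primal residual `A* u + B* v - c`. -/
def res (u : U) (v : V) : X := d.A.adjoint u + d.B.adjoint v - d.c

/-- The operator `A A*`. -/
def AAt : U →L[ℝ] U := d.A.comp d.A.adjoint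

/-- The operator `B B*`. -/
def BBt : V →L[ℝ] V := d.B.comp d.B.adjoint

/-- `H = Diag(D₁, D₂)`. -/
def H : WithLp 2 (U × V) →L[ℝ] WithLp 2 (U × V) := diag d.D₁ d.D₂

/-- `Q₁₁ + σ A A* + S ≻ 0` and `Q₂₂ + σ B B* + T ≻ 0`. -/
def ProxCondition : Prop :=
  IsPosDef (block11 d.Q + d.σ • d.AAt + d.S) ∧ IsPosDef (block22 d.Q + d.σ • d.BBt + d.T)

/-- `τ ∈ (0, 1]`, and
`⟨w, [Q + Diag(S + (1-τ)σ A A*, T + (1-τ)σ B B*)] w⟩ = 0` implies `‖u‖ ‖v‖ = 0`. -/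
def CaseA : Prop :=
  d.τ ∈ Ioc (0 : ℝ) 1 ∧
  ∀ (u : U) (v : V),
    sqNorm (d.Q + diag (d.S + ((1 - d.τ) * d.σ) • d.AAt) (d.T + ((1 - d.τ) * d.σ) • d.BBt))
      (pair u v) = 0 → ‖u‖ * ‖v‖ = 0

/-- `M = (1/4) Q + Diag(S - η D₁, T - η D₂)`. -/
def M : WithLp 2 (U × V) →L[ℝ] WithLp 2 (U × V) :=
  (1 / 4 : ℝ) • d.Q + diag (d.S - d.η • d.D₁) (d.T - d.η • d.D₂)

/-- `τ ∈ (0, (1+√5)/2)`, `M ⪰ 0`, `(1/4) Q₁₁ + S + σ A A* - η D₁ ≻ 0`,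
`(1/4) Q₂₂ + T + σ B B* - η D₂ ≻ 0`, and
`⟨w, [M + σ Diag(A A*, B B*)] w⟩ = 0` implies `‖u‖ ‖v‖ = 0`. -/
def CaseB : Prop :=
  d.τ ∈ Ioo (0 : ℝ) ((1 + √5) / 2) ∧
  d.M.IsPositive ∧
  IsPosDef ((1 / 4 : ℝ) • block11 d.Q + d.S + d.σ • d.AAt - d.η • d.D₁) ∧
  IsPosDef ((1 / 4 : ℝ) • block22 d.Q + d.T + d.σ • d.BBt - d.η • d.D₂) ∧
  ∀ (u : U) (v : V),
    sqNorm (d.M + d.σ • diag d.AAt d.BBt) (pair u v) = 0 → ‖u‖ * ‖v‖ = 0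

end Data

/-- The standing assumptions on the objective: `p`, `q` are closed proper convex, `φ` is convex with
a Lipschitz continuous gradient, `Q ⪯ W ⪯ Q + H` for every `W` in a generalized Hessian of `φ`, and
`|⟨u, (W₁₂ - Q₁₂) v⟩| ≤ (η/2) (‖u‖²_{D₁} + ‖v‖²_{D₂})` for all those `W` and all `u, v`. -/
structure Objective.Compatible (P : Objective U V) (d : Data U V X) : Prop where
  p_convex : IsClosedProperConvex P.p
  q_convex : IsClosedProperConvex P.q
  φ_smooth : IsSmoothConvex P.φ
  hessian_lower : ∀ w, ∀ W ∈ genHessian P.φ w, (W - d.Q).IsPositive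
  hessian_upper : ∀ w, ∀ W ∈ genHessian P.φ w, (d.Q + d.H - W).IsPositive
  cross_bound : ∀ w, ∀ W ∈ genHessian P.φ w, ∀ (u : U) (v : V),
    |inner ℝ u ((block12 W - block12 d.Q) v)| ≤ d.η / 2 * (sqNorm d.D₁ u + sqNorm d.D₂ v)

/-- `(u, v)` is an optimal solution of `min θ(u, v)` subject to `A* u + B* v = c`. -/
structure IsSolution (P : Objective U V) (d : Data U V X) (u : U) (v : V) : Prop where
  mem_dom : u ∈ dom P.p ∧ v ∈ dom P.q
  feasible : d.A.adjoint u + d.B.adjoint v = d.c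
  optimal : ∀ u' v', d.A.adjoint u' + d.B.adjoint v' = d.c → P.θ u v ≤ P.θ u' v'

/-- Constraint qualification: there is a feasible point in `ri(dom p × dom q)`. -/
def ConstraintQualification (P : Objective U V) (d : Data U V X) : Prop :=
  ∃ (u : U) (v : V), (u, v) ∈ intrinsicInterior ℝ (dom P.p ×ˢ dom P.q) ∧
    d.A.adjoint u + d.B.adjoint v = d.c

/-- The set-valued map `F(u, v, x) = ∇φ(u, v) + (∂p(u) + A x, ∂q(v) + B x)`. -/
def kktMap (P : Objective U V) (d : Data U V X) (u : U) (v : V) (x : X) :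
    Set (WithLp 2 (U × V)) :=
  {g | ∃ ξ ∈ subdiff P.p u, ∃ ζ ∈ subdiff P.q v,
    g = gradient P.φ (pair u v) + pair (ξ + d.A x) (ζ + d.B x)}

/-- The set of all `(u, v, x)` satisfying the KKT conditions `0 ∈ F(u, v, x)`, `A* u + B* v = c`:
the optimal solutions together with their multipliers. -/
def kktSet (P : Objective U V) (d : Data U V X) : Set (U × V × X) :=
  {z | (0 : WithLp 2 (U × V)) ∈ kktMap P d z.1 z.2.1 z.2.2 ∧
    d.A.adjoint z.1 + d.B.adjoint z.2.1 = d.c}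

/-- The majorization
`φ̂(w; w') = φ(w') + ⟨∇φ(w'), w - w'⟩ + (1/2) ‖w' - w‖²_{Q + H}`. -/
def majorant (P : Objective U V) (d : Data U V X) (w w' : WithLp 2 (U × V)) : ℝ :=
  P.φ w' + inner ℝ (gradient P.φ w') (w - w') + 1 / 2 * sqNorm (d.Q + d.H) (w' - w)

/-- The majorized augmented Lagrangian function `L̂_σ((u, v); (x, w'))`. -/
def majLagrangian (P : Objective U V) (d : Data U V X) (u : U) (v : V) (x : X)
    (w' : WithLp 2 (U × V)) : EReal :=
  P.p u + P.q v +
    ((majorant P d (pair u v) w' + inner ℝ x (d.res u v) + d.σ / 2 * ‖d.res u v‖ ^ 2 : ℝ) : EReal)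

/-- `(uᵏ, vᵏ, xᵏ)` is generated by the majorized ADMM: `u⁰ ∈ dom p`, `v⁰ ∈ dom q`, the iterates
`uᵏ⁺¹` and `vᵏ⁺¹` are global minimizers in the two subproblems, and the multiplier is updated with
step length `τ`. -/
structure IsGenerated (P : Objective U V) (d : Data U V X) (u : ℕ → U) (v : ℕ → V) (x : ℕ → X) :
    Prop where
  init : u 0 ∈ dom P.p ∧ v 0 ∈ dom P.q
  step_u : ∀ k, ∀ u' : U,
    majLagrangian P d (u (k + 1)) (v k) (x k) (pair (u k) (v k))
        + ((1 / 2 * sqNorm d.S (u (k + 1) - u k) : ℝ) : EReal)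
      ≤ majLagrangian P d u' (v k) (x k) (pair (u k) (v k))
        + ((1 / 2 * sqNorm d.S (u' - u k) : ℝ) : EReal)
  step_v : ∀ k, ∀ v' : V,
    majLagrangian P d (u (k + 1)) (v (k + 1)) (x k) (pair (u k) (v k))
        + ((1 / 2 * sqNorm d.T (v (k + 1) - v k) : ℝ) : EReal)
      ≤ majLagrangian P d (u (k + 1)) v' (x k) (pair (u k) (v k))
        + ((1 / 2 * sqNorm d.T (v' - v k) : ℝ) : EReal)
  step_x : ∀ k, x (k + 1) = x k + (d.τ * d.σ) • d.res (u (k + 1)) (v (k + 1))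

/-- `xTildeSucc d u v x k` is `x̃ᵏ⁺¹ = xᵏ + σ (A* uᵏ⁺¹ + B* vᵏ⁺¹ - c)`. -/
def xTildeSucc (d : Data U V X) (u : ℕ → U) (v : ℕ → V) (x : ℕ → X) (k : ℕ) : X :=
  x k + d.σ • d.res (u (k + 1)) (v (k + 1))

/-- The ergodic average `(1/k) (y¹ + ⋯ + yᵏ)`. -/
def average {E : Type*} [AddCommGroup E] [Module ℝ E] (y : ℕ → E) (k : ℕ) : E :=
  (1 / (k : ℝ)) • ∑ i ∈ Finset.Icc 1 k, y i

/-- `ûᵏ = (1/k) ∑_{i=1}^k uⁱ⁺¹` (likewise for `v̂ᵏ`). -/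
def avgShift {E : Type*} [AddCommGroup E] [Module ℝ E] (y : ℕ → E) (k : ℕ) : E :=
  average (fun i => y (i + 1)) k

/-- `x̂ᵏ = (1/k) ∑_{i=1}^k x̃ⁱ⁺¹`. -/
def xHat (d : Data U V X) (u : ℕ → U) (v : ℕ → V) (x : ℕ → X) (k : ℕ) : X :=
  average (xTildeSucc d u v x) k

/-- `(ũ, ṽ, x̃)` is an `ε`-approximate solution: for all `(u, v, x)` in the closed unit ball around
it, `(p(ũ) + q(ṽ)) - (p(u) + q(v)) + ⟨w̃ - w, ∇φ(w)⟩ + ⟨ũ - u, A x⟩ + ⟨ṽ - v, B x⟩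
- ⟨x̃ - x, A* u + B* v - c⟩ ≤ ε`. The possibly infinite term `p(u) + q(v)` is written on the
right-hand side, so that no difference of infinite values occurs. -/
def IsApproxSolution (P : Objective U V) (d : Data U V X) (ε : ℝ) (ut : U) (vt : V) (xt : X) :
    Prop :=
  ∀ (u : U) (v : V) (x : X),
    ‖u - ut‖ ^ 2 + ‖v - vt‖ ^ 2 + ‖x - xt‖ ^ 2 ≤ 1 →
    P.p ut + P.q vt
      + ((inner ℝ (pair ut vt - pair u v) (gradient P.φ (pair u v))
          + inner ℝ (ut - u) (d.A x) + inner ℝ (vt - v) (d.B x)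
          - inner ℝ (xt - x) (d.res u v) : ℝ) : EReal)
      ≤ P.p u + P.q v + (ε : EReal)

end Problem

end

end MajADMM

/-! The method is analysed through a Lyapunov function: a quadratic form in the distance to a
reference point, plus `σ` times a squared residual and a multiple of the squared multiplier error.
One sweep lowers it by at least twice the primal-dual gap to any reference point in the domain
(`IsGenerated.sweep`). The gradients at the current iterate cancel between the two subproblem
optimality conditions, the lower bound on `φ` with curvature `Q` and the upper bound with curvature
`Q + H`. What remains are exact quadratic identities and one indefinite term that couples the
residual to the change of `v`.

For `τ ≤ 1` this term is nonnegative. In case (b) it is controlled by comparing the `v`-optimality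
conditions of two consecutive sweeps (`IsGenerated.residual_coupling`); the squared residuals then
telescope exactly when `1 + τ - τ² ≥ 0`, which is the golden ratio bound. The remaining step
differences are absorbed by `M ⪰ 0` when the gap uses the linearization of `φ`, since the strong
convexity relative to `Q` is then still available. For the objective gap it has been spent, hence
the extra conditions on `S` and `T` in (iii).

Summation and Jensen's inequality give an `O(1/k)` gap at the averages. The gap relative to a KKT
point is nonnegative, so the Lyapunov function stays bounded and the multipliers with it; the
averaged residual is a telescoping sum of multiplier differences, which is (i). For (ii) the
reference point ranges over the unit ball around the average (`exists_uniform_bounds`); for (iii) it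
is a KKT point, and the term multiplier times residual is `O(1/k)` by (i).

Uniformity of the constants holds because every estimate is expressed through one KKT point and the
initial point (`IsGenerated.initial_bound`). A KKT point exists by `kktSet_nonempty`, and the
generalized Hessian enters only through `le_inner_gradient_sub`. -/

namespace MajADMM

set_option linter.unusedSectionVars false

/-! ### Quadratic forms of positive operators and the Euclidean product. -/

section Algebra

variable {E : Type*} [NormedAddCommGroup E] [InnerProductSpace ℝ E]
variable {U : Type*} [NormedAddCommGroup U] [InnerProductSpace ℝ U]
variable {V : Type*} [NormedAddCommGroup V] [InnerProductSpace ℝ V]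

theorem inner_symm_of_isPositive {G : E →L[ℝ] E} (hG : G.IsPositive) (x y : E) :
    inner ℝ x (G y) = inner ℝ y (G x) := by
  exact (hG.isSymmetric x y).symm.trans (real_inner_comm y (G x))

theorem sqNorm_nonneg {G : E →L[ℝ] E} (hG : G.IsPositive) (x : E) : 0 ≤ sqNorm G x :=
  hG.inner_nonneg_right x

theorem sqNorm_op_add (G G' : E →L[ℝ] E) (x : E) :
    sqNorm (G + G') x = sqNorm G x + sqNorm G' x := by
  simp [sqNorm, inner_add_right]

theorem sqNorm_op_sub (G G' : E →L[ℝ] E) (x : E) :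
    sqNorm (G - G') x = sqNorm G x - sqNorm G' x := by
  simp [sqNorm, inner_sub_right]

theorem sqNorm_op_smul (c : ℝ) (G : E →L[ℝ] E) (x : E) :
    sqNorm (c • G) x = c * sqNorm G x := by
  simp [sqNorm, inner_smul_right]

theorem sqNorm_smul (G : E →L[ℝ] E) (t : ℝ) (x : E) :
    sqNorm G (t • x) = t ^ 2 * sqNorm G x := by
  simp only [sqNorm, map_smul, inner_smul_right, inner_smul_left]
  simp; ring

theorem sqNorm_neg (G : E →L[ℝ] E) (x : E) : sqNorm G (-x) = sqNorm G x := by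
  simp [sqNorm]

theorem sqNorm_add {G : E →L[ℝ] E} (hG : G.IsPositive) (x y : E) :
    sqNorm G (x + y) = sqNorm G x + 2 * inner ℝ x (G y) + sqNorm G y := by
  simp only [sqNorm, map_add, inner_add_left, inner_add_right]
  linarith [inner_symm_of_isPositive hG x y]

theorem sqNorm_sub {G : E →L[ℝ] E} (hG : G.IsPositive) (x y : E) :
    sqNorm G (x - y) = sqNorm G x - 2 * inner ℝ x (G y) + sqNorm G y := by
  simp only [sqNorm, map_sub, inner_sub_left, inner_sub_right]
  linarith [inner_symm_of_isPositive hG x y]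

theorem abs_inner_le_sqNorm {G : E →L[ℝ] E} (hG : G.IsPositive) (x y : E) :
    |inner ℝ x (G y)| ≤ 1 / 2 * (sqNorm G x + sqNorm G y) := by
  have h1 := sqNorm_nonneg hG (x + y)
  have h2 := sqNorm_nonneg hG (x - y)
  rw [sqNorm_add hG] at h1
  rw [sqNorm_sub hG] at h2
  rw [abs_le]
  constructor <;> linarith

theorem sqNorm_add_le {G : E →L[ℝ] E} (hG : G.IsPositive) (x y : E) :
    sqNorm G (x + y) ≤ 2 * (sqNorm G x + sqNorm G y) := by
  rw [sqNorm_add hG]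
  linarith [abs_le.1 (abs_inner_le_sqNorm hG x y)]

theorem sqNorm_le (G : E →L[ℝ] E) (x : E) : sqNorm G x ≤ ‖G‖ * ‖x‖ ^ 2 := by
  have h1 : sqNorm G x ≤ ‖x‖ * ‖G x‖ := real_inner_le_norm x (G x)
  nlinarith [G.le_opNorm x, norm_nonneg x]

theorem convexOn_sqNorm {G : E →L[ℝ] E} (hG : G.IsPositive) :
    ConvexOn ℝ univ (sqNorm G) := by
  refine ⟨convex_univ, fun x _ y _ a b ha hb hab => ?_⟩
  obtain rfl : b = 1 - a := by linarith
  simp only [sqNorm_add hG, sqNorm_smul, map_smul, inner_smul_left, inner_smul_right, smul_eq_mul]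
  have h := sqNorm_nonneg hG (x - y)
  rw [sqNorm_sub hG] at h
  simp
  nlinarith [mul_nonneg ha hb]

/-- The algebraic identity behind the telescoping of the quadratic terms of one sweep. -/
theorem sweep_identity {G : E →L[ℝ] E} (hG : G.IsPositive) (a a' b b' : E) :
    -inner ℝ a (G (a - a')) - inner ℝ b (G ((a + b) - (a' + b')))
        + 1 / 2 * sqNorm G ((a + b) - (a' + b')) - 1 / 2 * sqNorm G (a' + b')
      = -(1 / 2) * (sqNorm G (a + b') + sqNorm G b - sqNorm G b') := by
  simp only [sqNorm, map_add, map_sub, inner_add_left, inner_add_right, inner_sub_left,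
    inner_sub_right]
  have h := inner_symm_of_isPositive hG
  linarith [h a b, h a a', h a b', h b a', h b b', h a' b']

/-- Three-point identity. -/
theorem three_point {G : E →L[ℝ] E} (hG : G.IsPositive) (a a' : E) :
    2 * inner ℝ a (G (a - a')) = sqNorm G a - sqNorm G a' + sqNorm G (a - a') := by
  rw [sqNorm_sub hG]
  simp only [sqNorm, map_sub, inner_sub_right]
  ring

@[simp] theorem pair_fst (u : U) (v : V) : (pair u v).fst = u := rfl
@[simp] theorem pair_snd (u : U) (v : V) : (pair u v).snd = v := rfl

theorem pair_add (a a' : U) (b b' : V) : pair a b + pair a' b' = pair (a + a') (b + b') := rfl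
theorem pair_sub (a a' : U) (b b' : V) : pair a b - pair a' b' = pair (a - a') (b - b') := rfl
theorem pair_smul (t : ℝ) (a : U) (b : V) : t • pair a b = pair (t • a) (t • b) := rfl
theorem pair_neg (a : U) (b : V) : -pair a b = pair (-a) (-b) := rfl
theorem pair_eta (w : WithLp 2 (U × V)) : pair w.fst w.snd = w := rfl

theorem inlL_apply (a : U) : (inlL a : WithLp 2 (U × V)) = pair a 0 := rfl
theorem inrL_apply (b : V) : (inrL b : WithLp 2 (U × V)) = pair 0 b := rfl
theorem projU_apply (w : WithLp 2 (U × V)) : projU w = w.fst := rfl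
theorem projV_apply (w : WithLp 2 (U × V)) : projV w = w.snd := rfl

theorem pair_split (a : U) (b : V) : pair a b = pair a 0 + pair 0 b := by
  simp [pair_add]

theorem inner_pair (a a' : U) (b b' : V) :
    inner ℝ (pair a b) (pair a' b') = inner ℝ a a' + inner ℝ b b' := by
  simp [WithLp.prod_inner_apply]

theorem inner_pair_left (a : U) (b : V) (w : WithLp 2 (U × V)) :
    inner ℝ (pair a b) w = inner ℝ a w.fst + inner ℝ b w.snd := by
  simp [WithLp.prod_inner_apply]

theorem diag_pair (G₁ : U →L[ℝ] U) (G₂ : V →L[ℝ] V) (a : U) (b : V) :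
    diag G₁ G₂ (pair a b) = pair (G₁ a) (G₂ b) := by
  simp [diag, inlL_apply, inrL_apply, projU_apply, projV_apply, pair_add]

theorem sqNorm_diag (G₁ : U →L[ℝ] U) (G₂ : V →L[ℝ] V) (a : U) (b : V) :
    sqNorm (diag G₁ G₂) (pair a b) = sqNorm G₁ a + sqNorm G₂ b := by
  simp [sqNorm, diag_pair]

theorem sqNorm_block22 (G : WithLp 2 (U × V) →L[ℝ] WithLp 2 (U × V)) (b : V) :
    sqNorm (block22 G) b = sqNorm G (pair 0 b) := by
  simp [sqNorm, block22, inrL_apply, projV_apply]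

theorem norm_pair_sq (a : U) (b : V) : ‖pair a b‖ ^ 2 = ‖a‖ ^ 2 + ‖b‖ ^ 2 := by
  rw [WithLp.prod_norm_sq_eq_of_L2]; rfl

theorem isPositive_mk {G : E →L[ℝ] E} (h : ∀ x y, inner ℝ x (G y) = inner ℝ y (G x))
    (h' : ∀ x, 0 ≤ sqNorm G x) : G.IsPositive := by
  rw [ContinuousLinearMap.isPositive_def]
  refine ⟨fun x y => ?_, fun x => ?_⟩
  · simp only [ContinuousLinearMap.coe_coe]
    rw [h x y, real_inner_comm]
  · simpa [ContinuousLinearMap.reApplyInnerSelf, real_inner_comm, sqNorm] using h' x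

theorem isPositive_diag {G₁ : U →L[ℝ] U} {G₂ : V →L[ℝ] V} (h₁ : G₁.IsPositive)
    (h₂ : G₂.IsPositive) : (diag G₁ G₂).IsPositive := by
  refine isPositive_mk (fun x y => ?_) (fun x => ?_)
  · rw [← pair_eta x, ← pair_eta y, diag_pair, diag_pair, inner_pair, inner_pair,
      inner_symm_of_isPositive h₁ x.fst, inner_symm_of_isPositive h₂ x.snd]
  · rw [← pair_eta x, sqNorm_diag]
    exact add_nonneg (sqNorm_nonneg h₁ _) (sqNorm_nonneg h₂ _)

theorem isPositive_block22 {G : WithLp 2 (U × V) →L[ℝ] WithLp 2 (U × V)} (h : G.IsPositive) :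
    (block22 G).IsPositive := by
  refine isPositive_mk (fun x y => ?_) (fun x => ?_)
  · have := inner_symm_of_isPositive h (pair 0 x) (pair 0 y)
    simp only [inner_pair_left, inner_zero_left, zero_add] at this
    exact this
  · rw [sqNorm_block22]
    exact sqNorm_nonneg h _

end Algebra

/-! ### Finite parts of extended-valued convex functions, first-order conditions, averages. -/

section ExtendedConvex

variable {E : Type*} [NormedAddCommGroup E] [InnerProductSpace ℝ E]

variable {f : E → EReal}

theorem IsClosedProperConvex.coe_toReal (hf : IsClosedProperConvex f) {x : E} (hx : x ∈ dom f) :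
    ((f x).toReal : EReal) = f x :=
  EReal.coe_toReal hx (hf.ne_bot x)

theorem IsClosedProperConvex.convexOn (hf : IsClosedProperConvex f) :
    ConvexOn ℝ (dom f) (fun x => (f x).toReal) := by
  have key : ∀ x ∈ dom f, ∀ y ∈ dom f, ∀ a b : ℝ, 0 ≤ a → 0 ≤ b → a + b = 1 →
      f (a • x + b • y) ≤ ((a * (f x).toReal + b * (f y).toReal : ℝ) : EReal) := by
    intro x hx y hy a b ha hb hab
    have h1 : (x, (f x).toReal) ∈ {z : E × ℝ | f z.1 ≤ (z.2 : EReal)} :=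
      (hf.coe_toReal hx).ge
    have h2 : (y, (f y).toReal) ∈ {z : E × ℝ | f z.1 ≤ (z.2 : EReal)} :=
      (hf.coe_toReal hy).ge
    simpa using hf.convex_epigraph h1 h2 ha hb hab
  have hd : ∀ x ∈ dom f, ∀ y ∈ dom f, ∀ a b : ℝ, 0 ≤ a → 0 ≤ b → a + b = 1 →
      a • x + b • y ∈ dom f := fun x hx y hy a b ha hb hab =>
    ((key x hx y hy a b ha hb hab).trans_lt (EReal.coe_lt_top _)).ne
  refine ⟨fun x hx y hy a b ha hb hab => hd x hx y hy a b ha hb hab,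
    fun x hx y hy a b ha hb hab => ?_⟩
  have := key x hx y hy a b ha hb hab
  rw [← hf.coe_toReal (hd x hx y hy a b ha hb hab)] at this
  exact_mod_cast this

/-- First-order optimality condition for the sum of a convex function and a function with a
quadratic upper expansion along the segment. -/
theorem first_order_of_convexOn {s : Set E} {p g : E → ℝ} (hp : ConvexOn ℝ s p) {x y : E}
    (hx : x ∈ s) (hy : y ∈ s) (hmin : ∀ z ∈ s, p x + g x ≤ p z + g z) {l m : ℝ}
    (hg : ∀ t : ℝ, 0 ≤ t → t ≤ 1 → g (x + t • (y - x)) ≤ g x + t * l + t ^ 2 * m) :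
    p x ≤ p y + l := by
  -- Minimality is tested on the segment towards `y`; dividing by `t` and letting `t ↓ 0` removes
  -- the quadratic term.
  have key : ∀ t : ℝ, 0 < t → t ≤ 1 → p x - p y - l ≤ t * m := by
    intro t ht ht1
    have e : x + t • (y - x) = (1 - t) • x + t • y := by
      rw [smul_sub, sub_smul, one_smul]; abel
    have hz : x + t • (y - x) ∈ s := by
      rw [e]; exact hp.1 hx hy (by linarith) ht.le (by ring)
    have h1 := hmin _ hz
    have h2 : p (x + t • (y - x)) ≤ (1 - t) * p x + t * p y := by
      rw [e]; exact hp.2 hx hy (by linarith) ht.le (by ring)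
    have h3 := hg t ht.le ht1
    have h4 : t * (p x - p y - l) ≤ t * (t * m) := by nlinarith
    exact le_of_mul_le_mul_left h4 ht
  have lim : Tendsto (fun t : ℝ => t * m) (𝓝[>] 0) (𝓝 0) := by
    have : Tendsto (fun t : ℝ => t * m) (𝓝 0) (𝓝 (0 * m)) :=
      (continuous_mul_const m).tendsto 0
    rw [zero_mul] at this
    exact this.mono_left nhdsWithin_le_nhds
  have := ge_of_tendsto lim (b := p x - p y - l) (by
    filter_upwards [Ioc_mem_nhdsGT (zero_lt_one : (0 : ℝ) < 1)] with t ht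
    exact key t ht.1 ht.2)
  linarith

theorem average_le_of_convexOn {s : Set E} {f : E → ℝ} (hf : ConvexOn ℝ s f) {y : ℕ → E}
    (hy : ∀ i, 1 ≤ i → y i ∈ s) {k : ℕ} (hk : 1 ≤ k) :
    average y k ∈ s ∧ f (average y k) ≤ 1 / (k : ℝ) * ∑ i ∈ Finset.Icc 1 k, f (y i) := by
  have hk' : (0 : ℝ) < k := by exact_mod_cast hk
  have h0 : ∀ i ∈ Finset.Icc 1 k, 0 ≤ (fun _ : ℕ => 1 / (k : ℝ)) i := fun i _ => by positivity
  have h1 : ∑ i ∈ Finset.Icc 1 k, (fun _ : ℕ => 1 / (k : ℝ)) i = 1 := by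
    simp; field_simp
  have h2 : ∀ i ∈ Finset.Icc 1 k, y i ∈ s := fun i hi => hy i (Finset.mem_Icc.1 hi).1
  have e : average y k = ∑ i ∈ Finset.Icc 1 k, (1 / (k : ℝ)) • y i := by
    rw [average, Finset.smul_sum]
  rw [e]
  refine ⟨hf.1.sum_mem h0 h1 h2, ?_⟩
  have := hf.map_sum_le h0 h1 h2
  simpa [Finset.mul_sum] using this

theorem average_map {F : Type*} [NormedAddCommGroup F] [InnerProductSpace ℝ F] (L : E →L[ℝ] F)
    (y : ℕ → E) (k : ℕ) : L (average y k) = average (fun i => L (y i)) k := by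
  simp [average]

theorem average_const_sub (y : ℕ → E) (c : E) {k : ℕ} (hk : 1 ≤ k) :
    average (fun i => y i - c) k = average y k - c := by
  have hk' : (k : ℝ) ≠ 0 := by positivity
  simp [average, Finset.sum_sub_distrib, smul_sub, ← Nat.cast_smul_eq_nsmul ℝ, smul_smul, hk']

end ExtendedConvex

/-! ### Mean value inequalities for the gradient under generalized Hessian bounds. -/

section MeanValue

variable {E : Type*} [NormedAddCommGroup E] [InnerProductSpace ℝ E] [FiniteDimensional ℝ E]

open MeasureTheory in
/-- Mean value inequality for a Lipschitz function whose directional derivative is bounded below at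
all points of differentiability. -/
theorem le_inner_sub_of_lipschitz {F : E → E} {L : NNReal} (hF : LipschitzWith L F) {g h : E}
    {m : ℝ} (hm : ∀ z, DifferentiableAt ℝ F z → m ≤ inner ℝ g (fderiv ℝ F z h)) (w : E) :
    m ≤ inner ℝ g (F (w + h) - F w) := by
  rw [inner_sub_right]
  set f : E → ℝ := fun z => inner ℝ g (F z) with hfdef
  have hf : LipschitzWith (‖g‖₊ * L) f := by
    refine LipschitzWith.of_dist_le_mul fun x y => ?_
    rw [Real.dist_eq, hfdef, ← inner_sub_right]
    refine (abs_real_inner_le_norm _ _).trans ?_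
    rw [NNReal.coe_mul, coe_nnnorm, mul_assoc]
    exact mul_le_mul_of_nonneg_left (by simpa [dist_eq_norm] using hF.dist_le_mul x y)
      (norm_nonneg _)
  change m ≤ f (w + h) - f w
  let _ : MeasurableSpace E := borel E
  have : BorelSpace E := ⟨rfl⟩
  -- The segment from `w` to `w + h` may miss the points of differentiability altogether. If the
  -- inequality failed at `w`, it would by continuity fail on a whole ball of base points, so
  -- averaging over that ball is enough.
  by_contra! hlt
  have hcont : Continuous fun z => f (z + h) - f z :=
    (hf.continuous.comp (continuous_id.add continuous_const)).sub hf.continuous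
  obtain ⟨δ, hδ, hball⟩ := Metric.isOpen_iff.1 (isOpen_lt hcont continuous_const) w hlt
  set μ : Measure E := Measure.addHaar
  set B : Set E := Metric.ball w δ
  have hBfin : μ B < ⊤ := measure_ball_lt_top
  have hBpos : 0 < μ.real B := ENNReal.toReal_pos (Metric.measure_ball_pos μ w hδ).ne' hBfin.ne
  have : IsFiniteMeasure (μ.restrict B) := ⟨by simpa using hBfin⟩
  have hint : ∀ t : ℝ, Integrable (fun z => f (z + t • h)) (μ.restrict B) := by
    intro t
    have hc : Continuous fun z => f (z + t • h) :=
      hf.continuous.comp (continuous_id.add continuous_const)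
    exact (hc.continuousOn.integrableOn_compact (isCompact_closedBall w δ)).mono_set
      Metric.ball_subset_closedBall
  -- Rademacher's theorem, with the translation invariance of Haar measure.
  have hae : ∀ t : ℝ, ∀ᵐ z ∂(μ.restrict B), DifferentiableAt ℝ F (z + t • h) := by
    intro t
    refine ae_restrict_of_ae ?_
    exact (measurePreserving_add_right μ (t • h)).quasiMeasurePreserving.ae
      hF.ae_differentiableAt
  have hline : ∀ z : E, ∀ t : ℝ, DifferentiableAt ℝ F (z + t • h) →
      HasDerivAt (fun s : ℝ => f (z + s • h)) (inner ℝ g (fderiv ℝ F (z + t • h) h)) t := by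
    intro z t hd
    have h1 : HasDerivAt (fun s : ℝ => z + s • h) ((1 : ℝ) • h) t :=
      ((hasDerivAt_id t).smul_const h).const_add z
    rw [one_smul] at h1
    have h2 := hd.hasFDerivAt.comp_hasDerivAt t h1
    exact ((innerSL ℝ g).hasFDerivAt.comp_hasDerivAt t h2)
  have hlip : ∀ z : E, LipschitzWith (‖g‖₊ * L * ‖h‖₊) fun s : ℝ => f (z + s • h) := by
    intro z
    refine LipschitzWith.of_dist_le_mul fun s t => ?_
    refine (hf.dist_le_mul _ _).trans ?_
    rw [dist_add_left, dist_eq_norm, ← sub_smul, norm_smul, NNReal.coe_mul _ ‖h‖₊, coe_nnnorm,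
      Real.dist_eq, Real.norm_eq_abs]
    exact le_of_eq (by ring)
  have hderiv : ∀ t : ℝ, Integrable (fun z => inner ℝ g (fderiv ℝ F (z + t • h) h)) (μ.restrict B) ∧
      HasDerivAt (fun s => ∫ z in B, f (z + s • h) ∂μ)
        (∫ z in B, inner ℝ g (fderiv ℝ F (z + t • h) h) ∂μ) t := by
    intro t
    refine hasDerivAt_integral_of_dominated_loc_of_lip (s := univ)
      (bound := fun _ => ((‖g‖₊ * L * ‖h‖₊ : NNReal) : ℝ)) univ_mem
      (Eventually.of_forall fun s => (hint s).aestronglyMeasurable) (hint t) ?_ ?_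
      (integrable_const _) ?_
    · have : Measurable fun z => inner ℝ g (fderiv ℝ F (z + t • h) h) :=
        (((measurable_fderiv_apply_const ℝ F h).comp (measurable_add_const _)).const_inner)
      exact this.aestronglyMeasurable
    · refine Eventually.of_forall fun z => ?_
      have := (hlip z).lipschitzOnWith (s := univ)
      simpa using this
    · filter_upwards [hae t] with z hz using hline z t hz
  have hge : ∀ t : ℝ, m * μ.real B ≤ ∫ z in B, inner ℝ g (fderiv ℝ F (z + t • h) h) ∂μ := by
    intro t
    have h1 : ∫ _ in B, m ∂μ ≤ ∫ z in B, inner ℝ g (fderiv ℝ F (z + t • h) h) ∂μ :=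
      integral_mono_ae (integrable_const _) (hderiv t).1 (by
        filter_upwards [hae t] with z hz using hm _ hz)
    simpa [mul_comm] using h1
  -- The averaged function of `s` is differentiable everywhere, so the classical mean value theorem
  -- on `[0, 1]` applies to it.
  obtain ⟨t, -, ht⟩ := exists_hasDerivAt_eq_slope (fun s => ∫ z in B, f (z + s • h) ∂μ) _
    (zero_lt_one : (0 : ℝ) < 1)
    (fun s _ => ((hderiv s).2.continuousAt).continuousWithinAt) (fun s _ => (hderiv s).2)
  have h2 := hge t
  rw [ht] at h2
  have h3 : ∫ z in B, (f (z + h) - f z) ∂μ < m * μ.real B := by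
    have i1 : Integrable (fun z => f (z + h)) (μ.restrict B) := by simpa using hint 1
    have i0 : Integrable f (μ.restrict B) := by simpa using hint 0
    have hpos : 0 < ∫ z in B, (m - (f (z + h) - f z)) ∂μ := by
      rw [setIntegral_pos_iff_support_of_nonneg_ae]
      · have : B ⊆ (Function.support fun z => m - (f (z + h) - f z)) ∩ B := by
          refine subset_inter (fun z hz => ?_) subset_rfl
          have : f (z + h) - f z < m := hball hz
          simp only [Function.mem_support]
          linarith
        exact (Metric.measure_ball_pos μ w hδ).trans_le (measure_mono this)
      · refine (ae_restrict_iff' measurableSet_ball).2 (Eventually.of_forall fun z hz => ?_)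
        have : f (z + h) - f z < m := hball hz
        simp only [Pi.zero_apply]
        linarith
      · exact (integrable_const m).sub (i1.sub i0)
    have i2 : Integrable (fun z => f (z + h) - f z) (μ.restrict B) := i1.sub i0
    rw [integral_sub (integrable_const m) i2] at hpos
    simp only [integral_const, smul_eq_mul, measureReal_restrict_apply_univ] at hpos
    linarith [mul_comm m (μ.real B)]
  rw [integral_sub (by simpa using hint 1) (by simpa using hint 0)] at h3
  simp only [one_smul, zero_smul, add_zero, sub_zero, div_one] at h2
  linarith

/-- Mean value inequality for the gradient, in terms of the generalized Hessian. -/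
theorem le_inner_gradient_sub {φ : E → ℝ} (hφ : IsSmoothConvex φ) {h g : E} {m : ℝ}
    (hm : ∀ z, ∀ W ∈ genHessian φ z, m ≤ inner ℝ g (W h)) (w : E) :
    m ≤ inner ℝ g (gradient φ (w + h) - gradient φ w) := by
  obtain ⟨L, hL⟩ := hφ.lipschitz_gradient
  refine le_inner_sub_of_lipschitz hL (fun z hz => ?_) w
  -- A Hessian that exists at `z` lies in the generalized Hessian, as the limit along the constant
  -- sequence.
  exact hm z _ (subset_convexHull ℝ _
    ⟨fun _ => z, tendsto_const_nhds, fun _ => hz, tendsto_const_nhds⟩)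

theorem hasDerivAt_comp_line {φ : E → ℝ} (hφ : IsSmoothConvex φ) (w h : E) (t : ℝ) :
    HasDerivAt (fun s : ℝ => φ (w + s • h)) (inner ℝ h (gradient φ (w + t • h))) t := by
  have h1 : HasDerivAt (fun s : ℝ => w + s • h) ((1 : ℝ) • h) t :=
    ((hasDerivAt_id t).smul_const h).const_add w
  rw [one_smul] at h1
  have h2 := (hφ.differentiable (w + t • h)).hasGradientAt.hasFDerivAt.comp_hasDerivAt t h1
  rw [real_inner_comm, ← InnerProductSpace.toDual_apply_apply (𝕜 := ℝ)]
  exact h2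

/-- Quadratic lower bound from a lower bound on the generalized Hessian. -/
theorem quadratic_lower {φ : E → ℝ} (hφ : IsSmoothConvex φ) {G : E →L[ℝ] E}
    (hG : ∀ z, ∀ W ∈ genHessian φ z, (W - G).IsPositive) (w h : E) :
    φ w + inner ℝ h (gradient φ w) + 1 / 2 * sqNorm G h ≤ φ (w + h) := by
  have hmono : ∀ t : ℝ, 0 ≤ t →
      t * sqNorm G h ≤ inner ℝ h (gradient φ (w + t • h) - gradient φ w) := by
    intro t ht
    refine le_inner_gradient_sub hφ (fun z W hW => ?_) w
    have := sqNorm_nonneg (hG z W hW) h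
    rw [sqNorm_op_sub] at this
    rw [map_smul, inner_smul_right]
    exact mul_le_mul_of_nonneg_left (by simpa [sqNorm] using this) ht
  have hd : ∀ t : ℝ, HasDerivAt
      (fun s : ℝ => φ (w + s • h) - s * inner ℝ h (gradient φ w) - 1 / 2 * s ^ 2 * sqNorm G h)
      (inner ℝ h (gradient φ (w + t • h)) - inner ℝ h (gradient φ w) - t * sqNorm G h) t := by
    intro t
    have h1 := hasDerivAt_comp_line hφ w h t
    have h2 := (hasDerivAt_id t).mul_const (inner ℝ h (gradient φ w))
    have h3 := (((hasDerivAt_id t).pow 2).const_mul (1 / 2)).mul_const (sqNorm G h)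
    refine ((h1.sub h2).sub h3).congr_deriv ?_
    simp
  have hm : MonotoneOn
      (fun s : ℝ => φ (w + s • h) - s * inner ℝ h (gradient φ w) - 1 / 2 * s ^ 2 * sqNorm G h)
      (Icc 0 1) := by
    refine monotoneOn_of_deriv_nonneg (convex_Icc 0 1)
      (fun t _ => (hd t).continuousAt.continuousWithinAt)
      (fun t _ => (hd t).differentiableAt.differentiableWithinAt) (fun t ht => ?_)
    rw [interior_Icc] at ht
    rw [(hd t).deriv]
    have := hmono t ht.1.le
    rw [inner_sub_right] at this
    linarith
  have := hm (left_mem_Icc.2 zero_le_one) (right_mem_Icc.2 zero_le_one) zero_le_one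
  simp only [one_smul, zero_smul, add_zero, zero_mul, one_mul, one_pow, mul_one, sub_zero, ne_eq,
    OfNat.ofNat_ne_zero, not_false_eq_true, zero_pow, mul_zero] at this
  linarith

/-- Quadratic upper bound from an upper bound on the generalized Hessian. -/
theorem quadratic_upper {φ : E → ℝ} (hφ : IsSmoothConvex φ) {G : E →L[ℝ] E}
    (hG : ∀ z, ∀ W ∈ genHessian φ z, (G - W).IsPositive) (w h : E) :
    φ (w + h) ≤ φ w + inner ℝ h (gradient φ w) + 1 / 2 * sqNorm G h := by
  have hmono : ∀ t : ℝ, 0 ≤ t →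
      inner ℝ h (gradient φ (w + t • h) - gradient φ w) ≤ t * sqNorm G h := by
    intro t ht
    -- Testing against `-h` turns the lower mean value inequality into an upper one.
    have := le_inner_gradient_sub hφ (g := -h) (h := t • h) (m := -(t * sqNorm G h))
      (fun z W hW => ?_) w
    · rw [inner_neg_left] at this
      linarith
    have := sqNorm_nonneg (hG z W hW) h
    rw [sqNorm_op_sub] at this
    rw [map_smul, inner_smul_right, inner_neg_left]
    have := mul_nonneg ht this
    simp only [sqNorm] at this ⊢
    linarith
  have hd : ∀ t : ℝ, HasDerivAt
      (fun s : ℝ => φ (w + s • h) - s * inner ℝ h (gradient φ w) - 1 / 2 * s ^ 2 * sqNorm G h)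
      (inner ℝ h (gradient φ (w + t • h)) - inner ℝ h (gradient φ w) - t * sqNorm G h) t := by
    intro t
    have h1 := hasDerivAt_comp_line hφ w h t
    have h2 := (hasDerivAt_id t).mul_const (inner ℝ h (gradient φ w))
    have h3 := (((hasDerivAt_id t).pow 2).const_mul (1 / 2)).mul_const (sqNorm G h)
    refine ((h1.sub h2).sub h3).congr_deriv ?_
    simp
  have hm : AntitoneOn
      (fun s : ℝ => φ (w + s • h) - s * inner ℝ h (gradient φ w) - 1 / 2 * s ^ 2 * sqNorm G h)
      (Icc 0 1) := by
    refine antitoneOn_of_deriv_nonpos (convex_Icc 0 1)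
      (fun t _ => (hd t).continuousAt.continuousWithinAt)
      (fun t _ => (hd t).differentiableAt.differentiableWithinAt) (fun t ht => ?_)
    rw [interior_Icc] at ht
    rw [(hd t).deriv]
    have := hmono t ht.1.le
    rw [inner_sub_right] at this
    linarith
  have := hm (left_mem_Icc.2 zero_le_one) (right_mem_Icc.2 zero_le_one) zero_le_one
  simp only [one_smul, zero_smul, add_zero, zero_mul, one_mul, one_pow, mul_one, sub_zero, ne_eq,
    OfNat.ofNat_ne_zero, not_false_eq_true, zero_pow, mul_zero] at this
  linarith

end MeanValue
-- Lagrange multipliers under a relative interior condition.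
section Multiplier

/-- The line through `w₀` and `w` stays in the affine span, where `w₀` is an interior point of `C`;
it can therefore be prolonged a little beyond `w₀` without leaving `C`. -/
theorem exists_reflect_of_mem_intrinsicInterior {E : Type*} [NormedAddCommGroup E]
    [NormedSpace ℝ E] {C : Set E} {w₀ : E} (h₀ : w₀ ∈ intrinsicInterior ℝ C) {w : E}
    (hw : w ∈ C) : ∃ ε : ℝ, 0 < ε ∧ w₀ + ε • (w₀ - w) ∈ C := by
  obtain ⟨z, hz, rfl⟩ := mem_intrinsicInterior.1 h₀
  set γ : ℝ → affineSpan ℝ C := fun t =>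
    ⟨AffineMap.lineMap (z : E) w (-t),
      AffineMap.lineMap_mem (-t) z.2 (subset_affineSpan ℝ C hw)⟩
  have hγ : Continuous γ := by
    refine Continuous.subtype_mk (f := fun t : ℝ => AffineMap.lineMap (z : E) w (-t)) ?_ _
    simp only [AffineMap.lineMap_apply]
    fun_prop
  have h0 : γ 0 = z := by simp [γ]
  have hnear : ∀ᶠ t in 𝓝 (0 : ℝ), γ t ∈ ((↑) ⁻¹' C : Set (affineSpan ℝ C)) :=
    hγ.continuousAt (by rw [h0]; exact mem_interior_iff_mem_nhds.1 hz)
  obtain ⟨ε, hε, h⟩ := Metric.eventually_nhds_iff.1 hnear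
  refine ⟨ε / 2, by positivity, ?_⟩
  have := @h (ε / 2) (by simp [abs_of_pos hε]; linarith)
  have e : ((γ (ε / 2) : affineSpan ℝ C) : E) = z + (ε / 2) • ((z : E) - w) := by
    change AffineMap.lineMap (z : E) w (-(ε / 2)) = _
    rw [AffineMap.lineMap_apply, vsub_eq_sub, vadd_eq_add, neg_smul, ← smul_neg, neg_sub, add_comm]
  rw [← e]
  exact this

variable {E X : Type*} [AddCommGroup E] [Module ℝ E] [AddCommGroup X] [Module ℝ X]

/-- The weighted mean of `w₁` and `w₂` serves all convex `θ` at once. This gives closure under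
addition for the two cones in `exists_multiplier`. If both weights vanish, any point of `C` will do.
-/
theorem convex_combination_cone {C : Set E} (hC : Convex ℝ C) (L : E →ₗ[ℝ] X) (c : X)
    {t₁ t₂ : ℝ} (h₁ : 0 ≤ t₁) (h₂ : 0 ≤ t₂) {w₁ w₂ : E} (hw₁ : w₁ ∈ C) (hw₂ : w₂ ∈ C) :
    ∃ w ∈ C, (t₁ + t₂) • (L w - c) = t₁ • (L w₁ - c) + t₂ • (L w₂ - c) ∧
      ∀ θ : E → ℝ, ConvexOn ℝ C θ → (t₁ + t₂) * θ w ≤ t₁ * θ w₁ + t₂ * θ w₂ := by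
  rcases (add_nonneg h₁ h₂).eq_or_lt with h | h
  · obtain rfl : t₁ = 0 := by linarith
    obtain rfl : t₂ = 0 := by linarith
    exact ⟨w₁, hw₁, by simp, by simp⟩
  · have e1 : 0 ≤ t₁ / (t₁ + t₂) := by positivity
    have e2 : 0 ≤ t₂ / (t₁ + t₂) := by positivity
    have e3 : t₁ / (t₁ + t₂) + t₂ / (t₁ + t₂) = 1 := by field_simp
    refine ⟨_, hC hw₁ hw₂ e1 e2 e3, ?_, fun θ hθ => ?_⟩
    · rw [map_add, map_smul, map_smul, smul_sub, smul_add, smul_smul, smul_smul,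
        mul_div_cancel₀ _ h.ne', mul_div_cancel₀ _ h.ne']
      module
    · have := mul_le_mul_of_nonneg_left (hθ.2 hw₁ hw₂ e1 e2 e3) h.le
      refine this.trans (le_of_eq ?_)
      simp only [smul_eq_mul]
      field_simp

/-- Lagrange multipliers for the minimization of a convex function under a linear constraint that
is satisfied by a point of the relative interior of the domain. -/
theorem exists_multiplier {C : Set E} {θ : E → ℝ} (hθ : ConvexOn ℝ C θ) (L : E →ₗ[ℝ] X) (c : X)
    {w₁ w₀ : E} (hw₁ : w₁ ∈ C) (hmin : ∀ w ∈ C, L w = c → θ w₁ ≤ θ w)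
    (hL₀ : L w₀ = c) (hri : ∀ w ∈ C, ∃ ε : ℝ, 0 < ε ∧ w₀ + ε • (w₀ - w) ∈ C) :
    ∃ l : X →ₗ[ℝ] ℝ, ∀ w ∈ C, θ w₁ ≤ θ w + l (L w - c) := by
  have hreflect : ∀ t : ℝ, 0 ≤ t → ∀ w ∈ C, ∃ t' : ℝ, 0 ≤ t' ∧ ∃ w' ∈ C,
      -(t • (L w - c)) = t' • (L w' - c) := by
    intro t ht w hw
    obtain ⟨ε, hε, h⟩ := hri w hw
    refine ⟨t / ε, by positivity, _, h, ?_⟩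
    rw [map_add, map_smul, map_sub, hL₀, add_sub_cancel_left, smul_smul,
      div_mul_cancel₀ _ hε.ne', ← smul_neg, neg_sub]
  -- The cone generated by `L(C) - c`; by the reflection through `w₀` it is closed under negation,
  -- hence a subspace.
  let Y : Submodule ℝ X :=
    { carrier := {y | ∃ t : ℝ, 0 ≤ t ∧ ∃ w ∈ C, y = t • (L w - c)}
      zero_mem' := ⟨0, le_rfl, w₁, hw₁, by simp⟩
      add_mem' := by
        rintro _ _ ⟨t, ht, w, hw, rfl⟩ ⟨t', ht', w', hw', rfl⟩
        obtain ⟨w'', hw'', e, -⟩ := convex_combination_cone hθ.1 L c ht ht' hw hw'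
        exact ⟨t + t', by positivity, w'', hw'', e.symm⟩
      smul_mem' := by
        rintro a _ ⟨t, ht, w, hw, rfl⟩
        rcases le_total 0 a with ha | ha
        · exact ⟨a * t, by positivity, w, hw, by rw [smul_smul]⟩
        · obtain ⟨t', ht', w', hw', e⟩ := hreflect (-a * t) (mul_nonneg (by linarith) ht) w hw
          refine ⟨t', ht', w', hw', ?_⟩
          rw [← e, smul_smul, neg_mul, neg_smul, neg_neg] }
  obtain ⟨Y', hY⟩ := Submodule.exists_isCompl Y
  -- The cone generated by the epigraph of the perturbation of the problem, with the optimal value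
  -- subtracted.
  let K : PointedCone ℝ (X × ℝ) :=
    { carrier := {y | ∃ t : ℝ, 0 ≤ t ∧ ∃ w ∈ C, y.1 = t • (L w - c) ∧ t * (θ w - θ w₁) ≤ y.2}
      zero_mem' := ⟨0, le_rfl, w₁, hw₁, by simp⟩
      add_mem' := by
        rintro ⟨y, s⟩ ⟨y', s'⟩ ⟨t, ht, w, hw, e, h⟩ ⟨t', ht', w', hw', e', h'⟩
        obtain ⟨w'', hw'', e'', h''⟩ := convex_combination_cone hθ.1 L c ht ht' hw hw'
        refine ⟨t + t', by positivity, w'', hw'', ?_, ?_⟩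
        · simp only [Prod.mk_add_mk] at e e' ⊢
          rw [e, e', e'']
        · have := h'' θ hθ
          simp only [Prod.mk_add_mk] at h h' ⊢
          linarith
      smul_mem' := by
        rintro ⟨a, ha⟩ ⟨y, s⟩ ⟨t, ht, w, hw, e, h⟩
        refine ⟨a * t, by positivity, w, hw, ?_, ?_⟩
        · change a • y = _
          simp only at e
          rw [e, smul_smul]
        · change _ ≤ a * s
          rw [mul_assoc]
          exact mul_le_mul_of_nonneg_left h ha }
  -- The functional `(y, s) ↦ s` on `Y' × ℝ`. A point of `K` in this domain has first component in
  -- `Y ∩ Y' = 0`, so it comes from a feasible `w` or from `t = 0`, and optimality makes `s`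
  -- nonnegative. Since `Y + Y'` is everything, each point can be shifted into `K` along the domain,
  -- and M. Riesz extension applies.
  let f : X × ℝ →ₗ.[ℝ] ℝ :=
    ⟨Y'.prod ⊤, (LinearMap.snd ℝ X ℝ).comp (Submodule.subtype _)⟩
  have hnonneg : ∀ x : f.domain, (x : X × ℝ) ∈ K → 0 ≤ f x := by
    rintro ⟨⟨y, s⟩, hy⟩ ⟨t, ht, w, hw, e, h⟩
    change 0 ≤ s
    simp only at e h
    have hy0 : y = 0 := by
      have : y ∈ Y ⊓ Y' := ⟨⟨t, ht, w, hw, e⟩, hy.1⟩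
      rw [hY.inf_eq_bot] at this
      exact this
    rcases ht.eq_or_lt with rfl | ht'
    · simpa using h
    · have : L w = c := by
        rw [hy0] at e
        exact sub_eq_zero.1 ((smul_eq_zero.1 e.symm).resolve_left ht'.ne')
      have := hmin w hw this
      nlinarith
  have hdense : ∀ y, ∃ x : f.domain, (x : X × ℝ) + y ∈ K := by
    rintro ⟨y, s⟩
    have : y ∈ Y ⊔ Y' := by rw [hY.sup_eq_top]; exact Submodule.mem_top
    obtain ⟨y₁, ⟨t, ht, w, hw, e⟩, y₂, hy₂, rfl⟩ := Submodule.mem_sup.1 this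
    refine ⟨⟨(-y₂, t * (θ w - θ w₁) - s), ⟨Y'.neg_mem hy₂, Submodule.mem_top⟩⟩,
      t, ht, w, hw, ?_, ?_⟩
    · simp [e]
    · simp
  obtain ⟨g, hgf, hgK⟩ := riesz_extension K f hnonneg hdense
  refine ⟨g.comp (LinearMap.inl ℝ X ℝ), fun w hw => ?_⟩
  have h1 : g (0, θ w - θ w₁) = θ w - θ w₁ :=
    hgf ⟨(0, θ w - θ w₁), ⟨Y'.zero_mem, Submodule.mem_top⟩⟩
  have h2 := hgK (L w - c, θ w - θ w₁) ⟨1, zero_le_one, w, hw, by simp, by simp⟩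
  have h3 : ((L w - c, θ w - θ w₁) : X × ℝ) = (L w - c, 0) + (0, θ w - θ w₁) := by simp
  rw [h3, map_add, h1] at h2
  simp only [LinearMap.comp_apply, LinearMap.inl_apply]
  linarith

end Multiplier

/-! ### KKT points: existence and variational inequality. -/

section KKT

variable {U V X : Type*}
variable [NormedAddCommGroup U] [InnerProductSpace ℝ U] [FiniteDimensional ℝ U]
variable [NormedAddCommGroup V] [InnerProductSpace ℝ V] [FiniteDimensional ℝ V]
variable [NormedAddCommGroup X] [InnerProductSpace ℝ X] [FiniteDimensional ℝ X]

theorem mem_subdiff_iff {f : U → EReal} (hf : IsClosedProperConvex f) {x ξ : U}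
    (hx : x ∈ dom f) :
    ξ ∈ subdiff f x ↔ ∀ y ∈ dom f, (f x).toReal + inner ℝ ξ (y - x) ≤ (f y).toReal := by
  constructor
  · intro h y hy
    have := h y
    rw [← hf.coe_toReal hx, ← hf.coe_toReal hy] at this
    exact_mod_cast this
  · intro h y
    by_cases hy : y ∈ dom f
    · have := h y hy
      rw [← hf.coe_toReal hx, ← hf.coe_toReal hy]
      exact_mod_cast this
    · have : f y = ⊤ := not_not.1 hy
      rw [this]
      exact le_top

theorem mem_dom_of_mem_subdiff {f : U → EReal} (hf : IsClosedProperConvex f) {x ξ : U}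
    (h : ξ ∈ subdiff f x) : x ∈ dom f := by
  intro hx
  obtain ⟨y, hy⟩ := hf.exists_ne_top
  have := h y
  rw [hx, EReal.top_add_coe] at this
  exact hy (top_le_iff.1 this)

/-- The finite part of the first function of the objective. -/
noncomputable def Objective.pr (P : Objective U V) (u : U) : ℝ := (P.p u).toReal

/-- The finite part of the second function of the objective. -/
noncomputable def Objective.qr (P : Objective U V) (v : V) : ℝ := (P.q v).toReal

/-- The finite part of the objective. -/
noncomputable def Objective.θr (P : Objective U V) (u : U) (v : V) : ℝ :=
  P.pr u + P.qr v + P.φ (pair u v)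

variable {P : Objective U V} {d : Data U V X}

theorem Objective.Compatible.coe_pr (hP : P.Compatible d) {u : U} (hu : u ∈ dom P.p) :
    (P.pr u : EReal) = P.p u := hP.p_convex.coe_toReal hu

theorem Objective.Compatible.coe_qr (hP : P.Compatible d) {v : V} (hv : v ∈ dom P.q) :
    (P.qr v : EReal) = P.q v := hP.q_convex.coe_toReal hv

theorem Objective.Compatible.coe_θr (hP : P.Compatible d) {u : U} (hu : u ∈ dom P.p) {v : V}
    (hv : v ∈ dom P.q) : P.θ u v = (P.θr u v : EReal) := by
  rw [Objective.θ, ← hP.coe_pr hu, ← hP.coe_qr hv, Objective.θr]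
  norm_cast

theorem Objective.Compatible.convexOn_pr (hP : P.Compatible d) : ConvexOn ℝ (dom P.p) P.pr :=
  hP.p_convex.convexOn

theorem Objective.Compatible.convexOn_qr (hP : P.Compatible d) : ConvexOn ℝ (dom P.q) P.qr :=
  hP.q_convex.convexOn

/-- Gradient inequality with the lower curvature `Q`. -/
theorem Objective.Compatible.φ_lower (hP : P.Compatible d) (w w' : WithLp 2 (U × V)) :
    P.φ w + inner ℝ (w' - w) (gradient P.φ w) + 1 / 2 * sqNorm d.Q (w' - w) ≤ P.φ w' := by
  simpa using quadratic_lower hP.φ_smooth hP.hessian_lower w (w' - w)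

/-- Descent inequality with the upper curvature `Q + H`. -/
theorem Objective.Compatible.φ_upper (hP : P.Compatible d) (w w' : WithLp 2 (U × V)) :
    P.φ w' ≤ P.φ w + inner ℝ (w' - w) (gradient P.φ w) + 1 / 2 * sqNorm (d.Q + d.H) (w' - w) := by
  simpa using quadratic_upper hP.φ_smooth hP.hessian_upper w (w' - w)

/-- With the multiplier, the optimal solution minimizes the Lagrangian without constraint. Varying
one block at a time gives the two subgradient inclusions, because `φ` is smooth. -/
theorem kktSet_nonempty (hP : P.Compatible d) {u₁ : U} {v₁ : V} (hs : IsSolution P d u₁ v₁)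
    (hq : ConstraintQualification P d) : (kktSet P d).Nonempty := by
  obtain ⟨u₀, v₀, h₀, hf₀⟩ := hq
  let L : U × V →ₗ[ℝ] X :=
    ((d.A.adjoint : U →ₗ[ℝ] X).comp (LinearMap.fst ℝ U V)) +
      ((d.B.adjoint : V →ₗ[ℝ] X).comp (LinearMap.snd ℝ U V))
  have hL : ∀ z : U × V, L z = d.A.adjoint z.1 + d.B.adjoint z.2 := fun z => rfl
  have hconv : ConvexOn ℝ (dom P.p ×ˢ dom P.q) fun z : U × V => P.θr z.1 z.2 := by
    refine ⟨hP.convexOn_pr.1.prod hP.convexOn_qr.1, fun x hx y hy a b ha hb hab => ?_⟩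
    have h1 := hP.convexOn_pr.2 hx.1 hy.1 ha hb hab
    have h2 := hP.convexOn_qr.2 hx.2 hy.2 ha hb hab
    have h3 := hP.φ_smooth.convex.2 (mem_univ (pair x.1 x.2)) (mem_univ (pair y.1 y.2)) ha hb hab
    simp only [pair_smul, pair_add, smul_eq_mul] at h1 h2 h3
    simp only [Objective.θr, smul_eq_mul, Prod.fst_add, Prod.snd_add, Prod.smul_fst, Prod.smul_snd]
    linarith
  obtain ⟨l, hl⟩ := exists_multiplier hconv L d.c (w₁ := (u₁, v₁)) (w₀ := (u₀, v₀)) hs.mem_dom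
    (fun w hw hLw => by
      have := hs.optimal w.1 w.2 hLw
      rw [hP.coe_θr hs.mem_dom.1 hs.mem_dom.2, hP.coe_θr hw.1 hw.2] at this
      exact_mod_cast this) hf₀
    (fun w hw => exists_reflect_of_mem_intrinsicInterior h₀ hw)
  set x : X := (InnerProductSpace.toDual ℝ X).symm (LinearMap.toContinuousLinearMap l)
  have hx : ∀ y, l y = inner ℝ x y := by
    intro y
    rw [InnerProductSpace.toDual_symm_apply]
    rfl
  have hfeas : d.A.adjoint u₁ + d.B.adjoint v₁ = d.c := hs.feasible
  set g := gradient P.φ (pair u₁ v₁)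
  refine ⟨(u₁, v₁, x), ?_, hfeas⟩
  refine ⟨-(g.fst + d.A x), ?_, -(g.snd + d.B x), ?_, ?_⟩
  · rw [mem_subdiff_iff hP.p_convex hs.mem_dom.1]
    intro y hy
    have := first_order_of_convexOn hP.convexOn_pr
      (g := fun u => P.φ (pair u v₁) + inner ℝ x (d.A.adjoint u + d.B.adjoint v₁ - d.c))
      (l := inner ℝ (y - u₁) g.fst + inner ℝ (y - u₁) (d.A x))
      (m := 1 / 2 * sqNorm (d.Q + d.H) (pair (y - u₁) 0)) hs.mem_dom.1 hy
      (fun z hz => by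
        have h1 := hl (z, v₁) ⟨hz, hs.mem_dom.2⟩
        rw [hx, hL] at h1
        simp only [Objective.θr] at h1
        rw [hfeas]
        simp only [sub_self, inner_zero_right]
        linarith)
      (fun t _ _ => by
        have h1 := hP.φ_upper (pair u₁ v₁) (pair (u₁ + t • (y - u₁)) v₁)
        have e : pair (u₁ + t • (y - u₁)) v₁ - pair u₁ v₁ = t • pair (y - u₁) (0 : V) := by
          simp [pair_sub, pair_smul]
        rw [e, sqNorm_smul, real_inner_smul_left, inner_pair_left, inner_zero_left] at h1
        have e2 : d.A.adjoint (u₁ + t • (y - u₁)) + d.B.adjoint v₁ - d.c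
            = t • d.A.adjoint (y - u₁) := by
          rw [map_add, map_smul, ← hfeas]; abel
        simp only [e2]
        rw [hfeas, sub_self, inner_zero_right, real_inner_smul_right,
          ContinuousLinearMap.adjoint_inner_right, real_inner_comm (y - u₁)]
        linarith)
    rw [inner_neg_left, inner_add_left, real_inner_comm (y - u₁) g.fst,
      real_inner_comm (y - u₁) (d.A x)]
    simp only [Objective.pr] at this
    linarith
  · rw [mem_subdiff_iff hP.q_convex hs.mem_dom.2]
    intro y hy
    have := first_order_of_convexOn hP.convexOn_qr
      (g := fun v => P.φ (pair u₁ v) + inner ℝ x (d.A.adjoint u₁ + d.B.adjoint v - d.c))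
      (l := inner ℝ (y - v₁) g.snd + inner ℝ (y - v₁) (d.B x))
      (m := 1 / 2 * sqNorm (d.Q + d.H) (pair 0 (y - v₁))) hs.mem_dom.2 hy
      (fun z hz => by
        have h1 := hl (u₁, z) ⟨hs.mem_dom.1, hz⟩
        rw [hx, hL] at h1
        simp only [Objective.θr] at h1
        rw [hfeas]
        simp only [sub_self, inner_zero_right]
        linarith)
      (fun t _ _ => by
        have h1 := hP.φ_upper (pair u₁ v₁) (pair u₁ (v₁ + t • (y - v₁)))
        have e : pair u₁ (v₁ + t • (y - v₁)) - pair u₁ v₁ = t • pair (0 : U) (y - v₁) := by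
          simp [pair_sub, pair_smul]
        rw [e, sqNorm_smul, real_inner_smul_left, inner_pair_left, inner_zero_left] at h1
        have e2 : d.A.adjoint u₁ + d.B.adjoint (v₁ + t • (y - v₁)) - d.c
            = t • d.B.adjoint (y - v₁) := by
          rw [map_add, map_smul, ← hfeas]; abel
        simp only [e2]
        rw [hfeas, sub_self, inner_zero_right, real_inner_smul_right,
          ContinuousLinearMap.adjoint_inner_right, real_inner_comm (y - v₁)]
        linarith)
    rw [inner_neg_left, inner_add_left, real_inner_comm (y - v₁) g.snd,
      real_inner_comm (y - v₁) (d.B x)]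
    simp only [Objective.qr] at this
    linarith
  · rw [← pair_eta (gradient P.φ (pair u₁ v₁)), pair_add]
    simp [g]
    rfl

/-- The consequences of the KKT conditions that the convergence analysis uses. -/
theorem kkt_inequality (hP : P.Compatible d) {z : U × V × X} (hz : z ∈ kktSet P d) :
    z.1 ∈ dom P.p ∧ z.2.1 ∈ dom P.q ∧ ∀ u ∈ dom P.p, ∀ v ∈ dom P.q,
      0 ≤ P.pr u + P.qr v - P.pr z.1 - P.qr z.2.1
        + inner ℝ (pair u v - pair z.1 z.2.1) (gradient P.φ (pair z.1 z.2.1))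
        + inner ℝ z.2.2 (d.res u v) := by
  obtain ⟨u₁, v₁, x₁⟩ := z
  obtain ⟨⟨ξ, hξ, ζ, hζ, e⟩, hf⟩ := hz
  simp only at hξ hζ e hf ⊢
  have hu := mem_dom_of_mem_subdiff hP.p_convex hξ
  have hv := mem_dom_of_mem_subdiff hP.q_convex hζ
  refine ⟨hu, hv, fun u hu' v hv' => ?_⟩
  have h1 := (mem_subdiff_iff hP.p_convex hu).1 hξ u hu'
  have h2 := (mem_subdiff_iff hP.q_convex hv).1 hζ v hv'
  have hg : gradient P.φ (pair u₁ v₁) = pair (-(ξ + d.A x₁)) (-(ζ + d.B x₁)) := by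
    rw [← pair_neg]
    exact eq_neg_of_add_eq_zero_left e.symm
  have hr : d.res u v = d.A.adjoint (u - u₁) + d.B.adjoint (v - v₁) := by
    rw [Data.res, ← hf, map_sub, map_sub]; abel
  rw [hg, hr, inner_add_right, ContinuousLinearMap.adjoint_inner_right,
    ContinuousLinearMap.adjoint_inner_right, pair_sub, inner_pair, inner_neg_right,
    inner_neg_right, inner_add_right, inner_add_right, real_inner_comm ξ, real_inner_comm ζ,
    real_inner_comm (d.A x₁), real_inner_comm (d.B x₁)]
  simp only [Objective.pr, Objective.qr]
  linarith

end KKT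
-- Optimality of the subproblems and the basic one-sweep inequality.
section Sweep

variable {U V X : Type*}
variable [NormedAddCommGroup U] [InnerProductSpace ℝ U] [FiniteDimensional ℝ U]
variable [NormedAddCommGroup V] [InnerProductSpace ℝ V] [FiniteDimensional ℝ V]
variable [NormedAddCommGroup X] [InnerProductSpace ℝ X] [FiniteDimensional ℝ X]
variable {P : Objective U V} {d : Data U V X}

theorem inner_H_left (d : Data U V X) (a a' : U) (b b' : V) :
    inner ℝ (pair a b) (d.H (pair a' b')) = inner ℝ a (d.D₁ a') + inner ℝ b (d.D₂ b') := by
  rw [Data.H, diag_pair, inner_pair]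

theorem sqNorm_H (d : Data U V X) (a : U) (b : V) :
    sqNorm d.H (pair a b) = sqNorm d.D₁ a + sqNorm d.D₂ b := sqNorm_diag _ _ _ _

theorem Data.Admissible.QH_pos (hd : d.Admissible) : (d.Q + d.H).IsPositive :=
  hd.Q_pos.add (isPositive_diag hd.D₁_pos hd.D₂_pos)

/-- The smooth part of the majorized augmented Lagrangian function. -/
noncomputable def smoothPart (P : Objective U V) (d : Data U V X) (u : U) (v : V) (x : X)
    (w' : WithLp 2 (U × V)) : ℝ :=
  majorant P d (pair u v) w' + inner ℝ x (d.res u v) + d.σ / 2 * ‖d.res u v‖ ^ 2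

theorem majLagrangian_eq (hP : P.Compatible d) {u : U} {v : V} (hu : u ∈ dom P.p)
    (hv : v ∈ dom P.q) (x : X) (w' : WithLp 2 (U × V)) :
    majLagrangian P d u v x w' = ((P.pr u + P.qr v + smoothPart P d u v x w' : ℝ) : EReal) := by
  rw [majLagrangian, ← hP.coe_pr hu, ← hP.coe_qr hv, smoothPart]
  norm_cast

theorem mem_dom_of_majLagrangian_ne_top (hP : P.Compatible d) {u : U} {v : V} {x : X}
    {w' : WithLp 2 (U × V)} {s : ℝ} (h : majLagrangian P d u v x w' + (s : EReal) ≠ ⊤) :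
    u ∈ dom P.p ∧ v ∈ dom P.q := by
  constructor
  · intro hu
    apply h
    rw [majLagrangian, hu, EReal.top_add_of_ne_bot (hP.q_convex.ne_bot v), EReal.top_add_coe,
      EReal.top_add_coe]
  · intro hv
    apply h
    rw [majLagrangian, hv, EReal.add_top_of_ne_bot (hP.p_convex.ne_bot u), EReal.top_add_coe,
      EReal.top_add_coe]

variable {u : ℕ → U} {v : ℕ → V} {x : ℕ → X}

/-- The previous iterate gives each subproblem a finite value, so its minimizer lies in the domain.
-/
theorem IsGenerated.mem_dom (h : IsGenerated P d u v x) (hP : P.Compatible d) (k : ℕ) :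
    u k ∈ dom P.p ∧ v k ∈ dom P.q := by
  induction k with
  | zero => exact h.init
  | succ k ih =>
    have h1 : u (k + 1) ∈ dom P.p := by
      have := h.step_u k (u k)
      rw [majLagrangian_eq hP ih.1 ih.2, ← EReal.coe_add] at this
      exact (mem_dom_of_majLagrangian_ne_top hP (this.trans_lt (EReal.coe_lt_top _)).ne).1
    have := h.step_v k (v k)
    rw [majLagrangian_eq hP h1 ih.2, ← EReal.coe_add] at this
    exact mem_dom_of_majLagrangian_ne_top hP (this.trans_lt (EReal.coe_lt_top _)).ne

theorem res_add (d : Data U V X) (u a : U) (v b : V) :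
    d.res (u + a) (v + b) = d.res u v + (d.A.adjoint a + d.B.adjoint b) := by
  simp only [Data.res, map_add]; abel

/-- The smooth part is quadratic, so the expansion is exact. Setting `b = 0` or `a = 0` yields the
optimality conditions of the two subproblems. -/
theorem smoothPart_expand (hd : d.Admissible) (u a : U) (v b : V) (x : X)
    (w' : WithLp 2 (U × V)) (t : ℝ) :
    smoothPart P d (u + t • a) (v + t • b) x w' = smoothPart P d u v x w'
      + t * (inner ℝ (pair a b) (gradient P.φ w')
        + inner ℝ (pair a b) ((d.Q + d.H) (pair u v - w'))
        + inner ℝ (x + d.σ • d.res u v) (d.A.adjoint a + d.B.adjoint b))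
      + t ^ 2 * (1 / 2 * sqNorm (d.Q + d.H) (pair a b)
        + d.σ / 2 * ‖d.A.adjoint a + d.B.adjoint b‖ ^ 2) := by
  have e1 : pair (u + t • a) (v + t • b) - w' = (pair u v - w') + t • pair a b := by
    rw [← pair_add, ← pair_smul]; abel
  have e2 : ∀ w : WithLp 2 (U × V), sqNorm (d.Q + d.H) (w' - w) = sqNorm (d.Q + d.H) (w - w') := by
    intro w
    rw [← neg_sub, sqNorm_neg]
  have e3 : d.res (u + t • a) (v + t • b)
      = d.res u v + t • (d.A.adjoint a + d.B.adjoint b) := by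
    rw [res_add, map_smul, map_smul, smul_add]
  have hs := inner_symm_of_isPositive hd.QH_pos (pair u v - w') (pair a b)
  simp only [smoothPart, majorant, e2, e1, e3]
  rw [sqNorm_add hd.QH_pos, sqNorm_smul, norm_add_sq_real, norm_smul, inner_add_right,
    inner_add_right, map_smul, inner_smul_right, inner_smul_right, inner_smul_right,
    inner_smul_right, hs, inner_add_left x, inner_smul_left, mul_pow, Real.norm_eq_abs, sq_abs,
    real_inner_comm (gradient P.φ w')]
  simp only [conj_trivial]
  ring

/-- Optimality condition of the first subproblem. -/
theorem IsGenerated.subgradient_u (h : IsGenerated P d u v x) (hd : d.Admissible)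
    (hP : P.Compatible d) (k : ℕ) {y : U} (hy : y ∈ dom P.p) :
    P.pr (u (k + 1)) ≤ P.pr y +
      (inner ℝ (pair (y - u (k + 1)) 0) (gradient P.φ (pair (u k) (v k)))
        + inner ℝ (pair (y - u (k + 1)) 0) (d.Q (pair (u (k + 1) - u k) 0))
        + inner ℝ (y - u (k + 1)) (d.D₁ (u (k + 1) - u k))
        + inner ℝ (x k + d.σ • d.res (u (k + 1)) (v k)) (d.A.adjoint (y - u (k + 1)))
        + inner ℝ (y - u (k + 1)) (d.S (u (k + 1) - u k))) := by
  have hk := h.mem_dom hP k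
  have hk1 := h.mem_dom hP (k + 1)
  refine first_order_of_convexOn hP.convexOn_pr
    (g := fun z => smoothPart P d z (v k) (x k) (pair (u k) (v k)) + 1 / 2 * sqNorm d.S (z - u k))
    (m := 1 / 2 * sqNorm (d.Q + d.H) (pair (y - u (k + 1)) 0)
        + d.σ / 2 * ‖d.A.adjoint (y - u (k + 1)) + d.B.adjoint 0‖ ^ 2
        + 1 / 2 * sqNorm d.S (y - u (k + 1)))
    hk1.1 hy (fun z hz => ?_) (fun t _ _ => le_of_eq ?_)
  · have := h.step_u k z
    rw [majLagrangian_eq hP hk1.1 hk.2, majLagrangian_eq hP hz hk.2] at this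
    norm_cast at this
    linarith
  · have h1 := smoothPart_expand (P := P) hd (u (k + 1)) (y - u (k + 1)) (v k) 0 (x k)
      (pair (u k) (v k)) t
    rw [smul_zero, add_zero] at h1
    have e : u (k + 1) + t • (y - u (k + 1)) - u k
        = (u (k + 1) - u k) + t • (y - u (k + 1)) := by abel
    simp only [h1, e]
    rw [sqNorm_add hd.S_pos, sqNorm_smul, map_smul, inner_smul_right, pair_sub, sub_self,
      add_apply, inner_add_right (pair _ _), inner_H_left, inner_zero_left,
      inner_symm_of_isPositive hd.S_pos (u (k + 1) - u k), map_zero, add_zero, add_zero]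
    ring

/-- Optimality condition of the second subproblem. -/
theorem IsGenerated.subgradient_v (h : IsGenerated P d u v x) (hd : d.Admissible)
    (hP : P.Compatible d) (k : ℕ) {y : V} (hy : y ∈ dom P.q) :
    P.qr (v (k + 1)) ≤ P.qr y +
      (inner ℝ (pair 0 (y - v (k + 1))) (gradient P.φ (pair (u k) (v k)))
        + inner ℝ (pair 0 (y - v (k + 1))) (d.Q (pair (u (k + 1) - u k) (v (k + 1) - v k)))
        + inner ℝ (y - v (k + 1)) (d.D₂ (v (k + 1) - v k))
        + inner ℝ (xTildeSucc d u v x k) (d.B.adjoint (y - v (k + 1)))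
        + inner ℝ (y - v (k + 1)) (d.T (v (k + 1) - v k))) := by
  have hk := h.mem_dom hP k
  have hk1 := h.mem_dom hP (k + 1)
  refine first_order_of_convexOn hP.convexOn_qr
    (g := fun z => smoothPart P d (u (k + 1)) z (x k) (pair (u k) (v k))
      + 1 / 2 * sqNorm d.T (z - v k))
    (m := 1 / 2 * sqNorm (d.Q + d.H) (pair 0 (y - v (k + 1)))
        + d.σ / 2 * ‖d.A.adjoint 0 + d.B.adjoint (y - v (k + 1))‖ ^ 2
        + 1 / 2 * sqNorm d.T (y - v (k + 1)))
    hk1.2 hy (fun z hz => ?_) (fun t _ _ => le_of_eq ?_)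
  · have := h.step_v k z
    rw [majLagrangian_eq hP hk1.1 hk1.2, majLagrangian_eq hP hk1.1 hz] at this
    norm_cast at this
    linarith
  · have h1 := smoothPart_expand (P := P) hd (u (k + 1)) 0 (v (k + 1)) (y - v (k + 1)) (x k)
      (pair (u k) (v k)) t
    rw [smul_zero, add_zero] at h1
    have e : v (k + 1) + t • (y - v (k + 1)) - v k
        = (v (k + 1) - v k) + t • (y - v (k + 1)) := by abel
    simp only [h1, e]
    rw [sqNorm_add hd.T_pos, sqNorm_smul, map_smul, inner_smul_right, pair_sub,
      add_apply, inner_add_right (pair _ _), inner_H_left, inner_zero_left,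
      inner_symm_of_isPositive hd.T_pos (v (k + 1) - v k), map_zero, zero_add, zero_add,
      xTildeSucc]
    ring

/-- The quadratic part of the Lyapunov function. -/
noncomputable def lyapunov (d : Data U V X) (G : WithLp 2 (U × V) →L[ℝ] WithLp 2 (U × V))
    (u' : U) (v' : V) (x' : X) (u : U) (v : V) (x : X) : ℝ :=
  sqNorm G (pair (u' - u) (v' - v)) + d.σ * ‖d.res u v'‖ ^ 2
    + 1 / (d.τ * d.σ) * ‖x' - x‖ ^ 2

/-- The operator of the basic Lyapunov function. -/
noncomputable def baseOp (d : Data U V X) : WithLp 2 (U × V) →L[ℝ] WithLp 2 (U × V) :=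
  diag (d.D₁ + d.S) (block22 d.Q + d.D₂ + d.T)

theorem sqNorm_baseOp (d : Data U V X) (a : U) (b : V) :
    sqNorm (baseOp d) (pair a b) = sqNorm d.D₁ a + sqNorm d.S a
      + (sqNorm d.Q (pair 0 b) + sqNorm d.D₂ b + sqNorm d.T b) := by
  simp only [baseOp, sqNorm_diag, sqNorm_op_add, sqNorm_block22]

theorem Data.Admissible.baseOp_pos (hd : d.Admissible) : (baseOp d).IsPositive :=
  isPositive_diag (hd.D₁_pos.add hd.S_pos)
    (((isPositive_block22 hd.Q_pos).add hd.D₂_pos).add hd.T_pos)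

/-- The nonsmooth part of the primal-dual gap between `(u', v', x')` and `(u, v, x)`. -/
noncomputable def gap (P : Objective U V) (d : Data U V X)
    (u' : U) (v' : V) (x' : X) (u : U) (v : V) (x : X) : ℝ :=
  P.pr u' + P.qr v' - P.pr u - P.qr v + inner ℝ x (d.res u' v') - inner ℝ x' (d.res u v)

/-- Collects all multiplier and penalty terms of a sweep. There `α`, `β`, `β'` are the images under
the adjoints of the new `u`-error, the new `v`-error and the old `v`-error, `ρ` is the residual of
the reference point, and `α + β + ρ` is the new residual. -/
theorem multiplier_identity {σ τ : ℝ} (hσ : 0 < σ) (hτ : 0 < τ) (α β β' ρ x₀ x : X) :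
    2 * (inner ℝ (x₀ + σ • (α + β' + ρ)) (-α) + inner ℝ (x₀ + σ • (α + β + ρ)) (-β)
        + inner ℝ x (α + β + ρ) - inner ℝ (x₀ + σ • (α + β + ρ)) ρ)
      + σ * ‖β + ρ‖ ^ 2 + 1 / (τ * σ) * ‖x₀ + (τ * σ) • (α + β + ρ) - x‖ ^ 2
      + (σ * ‖β - β'‖ ^ 2 - 2 * σ * inner ℝ (α + β + ρ) (β - β')
        + (2 - τ) * σ * ‖α + β + ρ‖ ^ 2)
      = σ * ‖β' + ρ‖ ^ 2 + 1 / (τ * σ) * ‖x₀ - x‖ ^ 2 := by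
  have e : x₀ + (τ * σ) • (α + β + ρ) - x = (x₀ - x) + (τ * σ) • (α + β + ρ) := by abel
  have e2 : 1 / (τ * σ) * ‖(x₀ - x) + (τ * σ) • (α + β + ρ)‖ ^ 2
      = 1 / (τ * σ) * ‖x₀ - x‖ ^ 2 + 2 * inner ℝ (x₀ - x) (α + β + ρ)
        + τ * σ * ‖α + β + ρ‖ ^ 2 := by
    rw [norm_add_sq_real, norm_smul, inner_smul_right, mul_pow, Real.norm_eq_abs, sq_abs]
    field_simp
  rw [e, e2]
  simp only [← real_inner_self_eq_norm_sq (β + ρ), ← real_inner_self_eq_norm_sq (β - β'),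
    ← real_inner_self_eq_norm_sq (α + β + ρ), ← real_inner_self_eq_norm_sq (β' + ρ),
    inner_add_left, inner_add_right, inner_sub_left, inner_sub_right, inner_neg_right,
    real_inner_smul_left]
  rw [real_inner_comm α β, real_inner_comm α β', real_inner_comm α ρ, real_inner_comm β β',
    real_inner_comm β ρ, real_inner_comm β' ρ]
  ring

/-- One sweep of the method: the change of the basic Lyapunov function bounds the gap. -/
theorem IsGenerated.sweep (h : IsGenerated P d u v x) (hd : d.Admissible)
    (hP : P.Compatible d) (k : ℕ) {u' : U} (hu : u' ∈ dom P.p) {v' : V} (hv : v' ∈ dom P.q)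
    (x' : X) :
    2 * (gap P d (u (k + 1)) (v (k + 1)) (xTildeSucc d u v x k) u' v' x'
        + P.φ (pair (u (k + 1)) (v (k + 1))) - P.φ (pair u' v'))
      + lyapunov d (baseOp d) (u (k + 1)) (v (k + 1)) (x (k + 1)) u' v' x'
      + sqNorm d.S (u (k + 1) - u k) + sqNorm d.T (v (k + 1) - v k)
      + sqNorm d.Q (pair (u (k + 1) - u') (v k - v'))
      + (d.σ * ‖d.B.adjoint (v (k + 1) - v k)‖ ^ 2
        - 2 * d.σ * inner ℝ (d.res (u (k + 1)) (v (k + 1))) (d.B.adjoint (v (k + 1) - v k))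
        + (2 - d.τ) * d.σ * ‖d.res (u (k + 1)) (v (k + 1))‖ ^ 2)
      ≤ lyapunov d (baseOp d) (u k) (v k) (x k) u' v' x' := by
  have h1 := h.subgradient_u hd hP k hu
  have h2 := h.subgradient_v hd hP k hv
  have h3 := hP.φ_lower (pair (u k) (v k)) (pair u' v')
  have h4 := hP.φ_upper (pair (u k) (v k)) (pair (u (k + 1)) (v (k + 1)))
  rw [pair_sub] at h3 h4
  rw [lyapunov, lyapunov, sqNorm_baseOp, sqNorm_baseOp, gap, h.step_x k]
  rw [xTildeSucc] at h2 ⊢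
  -- New errors are `a`, `b` and old errors `a'`, `b'`, all relative to the reference point; in
  -- these variables the claim is a linear combination of the identities below.
  obtain ⟨a, ha⟩ : ∃ a, a = u (k + 1) - u' := ⟨_, rfl⟩
  obtain ⟨a', ha'⟩ : ∃ a', a' = u k - u' := ⟨_, rfl⟩
  obtain ⟨b, hb⟩ : ∃ b, b = v (k + 1) - v' := ⟨_, rfl⟩
  obtain ⟨b', hb'⟩ : ∃ b', b' = v k - v' := ⟨_, rfl⟩
  have eu : u (k + 1) - u k = a - a' := by rw [ha, ha']; abel
  have ev : v (k + 1) - v k = b - b' := by rw [hb, hb']; abel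
  have e1 : u' - u (k + 1) = -a := by rw [ha]; abel
  have e2 : v' - v (k + 1) = -b := by rw [hb]; abel
  have e3 : u' - u k = -a' := by rw [ha']; abel
  have e4 : v' - v k = -b' := by rw [hb']; abel
  have r1 : d.res (u (k + 1)) (v (k + 1))
      = d.A.adjoint a + d.B.adjoint b + d.res u' v' := by
    rw [ha, hb, Data.res, Data.res, map_sub, map_sub]; abel
  have r2 : d.res (u (k + 1)) (v k) = d.A.adjoint a + d.B.adjoint b' + d.res u' v' := by
    rw [ha, hb', Data.res, Data.res, map_sub, map_sub]; abel
  have r3 : d.res u' (v (k + 1)) = d.B.adjoint b + d.res u' v' := by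
    rw [hb, Data.res, Data.res, map_sub]; abel
  have r4 : d.res u' (v k) = d.B.adjoint b' + d.res u' v' := by
    rw [hb', Data.res, Data.res, map_sub]; abel
  rw [← ha, ← ha', ← hb, ← hb', eu, ev, r1, r3, r4]
  rw [e1, eu, r2] at h1
  rw [e2, eu, ev, r1] at h2
  rw [e3, e4] at h3
  rw [eu, ev] at h4
  have hm := multiplier_identity hd.σ_pos hd.τ_pos (d.A.adjoint a) (d.B.adjoint b)
    (d.B.adjoint b') (d.res u' v') (x k) x'
  have hQ := sweep_identity hd.Q_pos (pair a 0) (pair a' 0) (pair 0 b) (pair (0 : U) b')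
  have tD₁ := three_point hd.D₁_pos a a'
  have tD₂ := three_point hd.D₂_pos b b'
  have tS := three_point hd.S_pos a a'
  have tT := three_point hd.T_pos b b'
  simp only [pair_add, pair_sub, add_zero, zero_add, sub_zero] at hQ
  -- The four gradient terms, from the two subproblems and the two bounds on `φ`, all sit at the
  -- current iterate and their directions sum to zero.
  have eg : inner ℝ (pair (-a) 0) (gradient P.φ (pair (u k) (v k)))
      + inner ℝ (pair 0 (-b)) (gradient P.φ (pair (u k) (v k)))
      - inner ℝ (pair (-a') (-b')) (gradient P.φ (pair (u k) (v k)))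
      + inner ℝ (pair (a - a') (b - b')) (gradient P.φ (pair (u k) (v k))) = 0 := by
    rw [← inner_add_left, ← inner_sub_left, ← inner_add_left, pair_add, pair_sub, pair_add]
    have : pair (-a + 0 - -a' + (a - a')) (0 + -b - -b' + (b - b'))
        = (0 : WithLp 2 (U × V)) := by
      have z1 : -a + 0 - -a' + (a - a') = 0 := by abel
      have z2 : 0 + -b - -b' + (b - b') = 0 := by abel
      rw [z1, z2]; rfl
    rw [this, inner_zero_left]
  have n1 : ∀ w, inner ℝ (pair (-a) (0 : V)) w = -inner ℝ (pair a 0) w := by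
    intro w
    rw [← inner_neg_left, pair_neg, neg_zero]
  have n2 : ∀ w, inner ℝ (pair (0 : U) (-b)) w = -inner ℝ (pair 0 b) w := by
    intro w
    rw [← inner_neg_left, pair_neg, neg_zero]
  rw [← pair_neg, sqNorm_neg] at h3
  rw [← pair_neg] at eg
  rw [sqNorm_op_add, sqNorm_H] at h4
  rw [n1, n1, inner_neg_left a, inner_neg_left a, map_neg] at h1
  rw [n2, n2, inner_neg_left b, inner_neg_left b, map_neg] at h2
  rw [n1, n2] at eg
  rw [map_sub d.B.adjoint]
  linarith

end Sweep
-- Descent of the Lyapunov function in the two step length regimes.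
section Descent

variable {U V X : Type*}
variable [NormedAddCommGroup U] [InnerProductSpace ℝ U] [FiniteDimensional ℝ U]
variable [NormedAddCommGroup V] [InnerProductSpace ℝ V] [FiniteDimensional ℝ V]
variable [NormedAddCommGroup X] [InnerProductSpace ℝ X] [FiniteDimensional ℝ X]
variable {P : Objective U V} {d : Data U V X}

/-- Lower bound on the change of the second block of the gradient. -/
theorem Objective.Compatible.gradient_snd_lower (hP : P.Compatible d)
    (w : WithLp 2 (U × V)) (a : U) (b b' : V) :
    inner ℝ (pair 0 b') (d.Q (pair a b)) + inner ℝ b' (d.D₂ b)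
        - d.η / 2 * (sqNorm d.D₁ a + sqNorm d.D₂ b') - 1 / 2 * (sqNorm d.D₂ b + sqNorm d.D₂ b')
      ≤ inner ℝ (pair 0 b') (gradient P.φ (w + pair a b) - gradient P.φ w) := by
  refine le_inner_gradient_sub hP.φ_smooth (fun z W hW => ?_) w
  -- Let `E = W - Q`, so `0 ⪯ E ⪯ H`. Its off-diagonal part is bounded by the cross condition, after
  -- transposition by symmetry. Its `(2,2)` part is bounded by Cauchy–Schwarz for `H - E`, which
  -- produces the term `⟨b', D₂ b⟩`.
  have hl := hP.hessian_lower z W hW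
  have hu := hP.hessian_upper z W hW
  have h1 := inner_symm_of_isPositive hl (pair 0 b') (pair a 0)
  have h2 : inner ℝ (pair a (0 : V)) ((W - d.Q) (pair 0 b'))
      = inner ℝ a ((block12 W - block12 d.Q) b') := by
    rw [inner_pair_left, inner_zero_left, add_zero]
    rfl
  have h3 := (abs_le.1 (hP.cross_bound z W hW a b')).1
  have h4 := (abs_le.1 (abs_inner_le_sqNorm hu (pair 0 b') (pair 0 b))).2
  have h5 := sqNorm_nonneg hl (pair 0 b)
  have h6 := sqNorm_nonneg hl (pair 0 b')
  have h7 : ∀ c : V, sqNorm (d.Q + d.H - W) (pair 0 c)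
      = sqNorm d.D₂ c - sqNorm (W - d.Q) (pair 0 c) := by
    intro c
    have h0 : sqNorm d.D₁ 0 = 0 := by simp [sqNorm]
    rw [sqNorm_op_sub, sqNorm_op_sub, sqNorm_op_add, sqNorm_H, h0]
    ring
  rw [h7, h7] at h4
  rw [pair_split a b, map_add, map_add, inner_add_right, inner_add_right]
  simp only [sub_apply, add_apply, inner_sub_right, inner_add_right] at h1 h2 h3 h4
  rw [inner_H_left, inner_zero_left] at h4
  rw [← inner_sub_right (𝕜 := ℝ) a] at h2 h3
  linarith

variable {u : ℕ → U} {v : ℕ → V} {x : ℕ → X}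

/-- Bound on the coupling of the residual with the change of `v`, from the monotonicity of the
subdifferential of `q` between consecutive sweeps. -/
theorem IsGenerated.residual_coupling (h : IsGenerated P d u v x) (hd : d.Admissible)
    (hP : P.Compatible d) (k : ℕ) :
    2 * d.σ * inner ℝ (d.res (u (k + 2)) (v (k + 2))) (d.B.adjoint (v (k + 2) - v (k + 1)))
      ≤ d.σ * ‖d.B.adjoint (v (k + 2) - v (k + 1))‖ ^ 2
        + (d.τ - 1) ^ 2 * d.σ * ‖d.res (u (k + 1)) (v (k + 1))‖ ^ 2
        - 2 * inner ℝ (pair 0 (v (k + 2) - v (k + 1)))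
          (d.Q (pair (u (k + 2) - u (k + 1)) (v (k + 2) - v (k + 1))))
        + d.η * (sqNorm d.D₁ (u (k + 1) - u k) + sqNorm d.D₂ (v (k + 2) - v (k + 1)))
        + (sqNorm d.D₂ (v (k + 1) - v k) + sqNorm d.T (v (k + 1) - v k))
        - (sqNorm d.D₂ (v (k + 2) - v (k + 1)) + sqNorm d.T (v (k + 2) - v (k + 1))) := by
  -- Each of two consecutive `v`-iterates is tested against the other, so that the values of `q`
  -- cancel in the sum.
  have h1 := h.subgradient_v hd hP (k + 1) (h.mem_dom hP (k + 1)).2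
  have h2 := h.subgradient_v hd hP k (h.mem_dom hP (k + 2)).2
  have h3 := hP.gradient_snd_lower (pair (u k) (v k)) (u (k + 1) - u k) (v (k + 1) - v k)
    (v (k + 2) - v (k + 1))
  have e0 : pair (u k) (v k) + pair (u (k + 1) - u k) (v (k + 1) - v k)
      = pair (u (k + 1)) (v (k + 1)) := by
    rw [pair_add, add_sub_cancel, add_sub_cancel]
  rw [e0] at h3
  simp only [Nat.add_assoc, Nat.reduceAdd] at h1
  have e1 : v (k + 1) - v (k + 2) = -(v (k + 2) - v (k + 1)) := by abel
  rw [e1] at h1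
  obtain ⟨δ, hδ⟩ : ∃ δ, δ = v (k + 2) - v (k + 1) := ⟨_, rfl⟩
  obtain ⟨δ₀, hδ₀⟩ : ∃ δ₀, δ₀ = v (k + 1) - v k := ⟨_, rfl⟩
  rw [← hδ] at h1 h2 h3 ⊢
  rw [← hδ₀] at h2 h3 ⊢
  have n2 : ∀ w, inner ℝ (pair (0 : U) (-δ)) w = -inner ℝ (pair 0 δ) w := by
    intro w
    rw [← inner_neg_left, pair_neg, neg_zero]
  rw [n2, n2, inner_neg_left δ, inner_neg_left δ, map_neg, inner_neg_right] at h1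
  have e2 : xTildeSucc d u v x (k + 1) = xTildeSucc d u v x k
      + d.σ • (d.res (u (k + 2)) (v (k + 2)) + (d.τ - 1) • d.res (u (k + 1)) (v (k + 1))) := by
    simp only [xTildeSucc, h.step_x k]
    module
  rw [e2, inner_add_left, real_inner_smul_left, inner_add_left, real_inner_smul_left] at h1
  have hT := (abs_le.1 (abs_inner_le_sqNorm hd.T_pos δ δ₀)).2
  -- Young's inequality for the old residual, which enters with factor `τ - 1` because the
  -- multiplier step is `τσ` and not `σ`.
  have hr : 0 ≤ d.σ * ‖d.B.adjoint δ + (d.τ - 1) • d.res (u (k + 1)) (v (k + 1))‖ ^ 2 :=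
    mul_nonneg hd.σ_pos.le (sq_nonneg _)
  rw [norm_add_sq_real, norm_smul, mul_pow, Real.norm_eq_abs, sq_abs, real_inner_smul_right,
    real_inner_comm (d.res (u (k + 1)) (v (k + 1))) (d.B.adjoint δ)] at hr
  rw [inner_sub_right] at h3
  simp only [sqNorm] at *
  linarith

/-- The additional terms of the Lyapunov function for step lengths beyond `1`. -/
noncomputable def auxLyapunov (d : Data U V X) (u : ℕ → U) (v : ℕ → V) (k : ℕ) : ℝ :=
  sqNorm d.D₂ (v (k + 1) - v k) + sqNorm d.T (v (k + 1) - v k)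
    + d.η * sqNorm d.D₁ (u (k + 1) - u k) + (2 - d.τ) * d.σ * ‖d.res (u (k + 1)) (v (k + 1))‖ ^ 2

/-- With `ω`, `ω'` the old and new errors and `δ` the change of `v` alone, the `Q`-terms of the
sweep and of the residual coupling become a telescoping difference plus a nonnegative rest. This is
why `Q` is added to the Lyapunov operator. -/
theorem coupling_identity {E : Type*} [NormedAddCommGroup E] [InnerProductSpace ℝ E]
    {G : E →L[ℝ] E} (hG : G.IsPositive) (ω ω' δ : E) :
    sqNorm G (ω' - δ) + 2 * inner ℝ δ (G (ω' - ω))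
      = sqNorm G ω' - sqNorm G ω + sqNorm G (ω - δ) := by
  rw [sqNorm_sub hG, sqNorm_sub hG, map_sub, inner_sub_right, inner_symm_of_isPositive hG ω' δ,
    inner_symm_of_isPositive hG ω δ]
  ring

theorem lyapunov_op_add (d : Data U V X) (G G' : WithLp 2 (U × V) →L[ℝ] WithLp 2 (U × V))
    (u' : U) (v' : V) (x' : X) (u : U) (v : V) (x : X) :
    lyapunov d (G + G') u' v' x' u v x
      = lyapunov d G u' v' x' u v x + sqNorm G' (pair (u' - u) (v' - v)) := by
  simp only [lyapunov, sqNorm_op_add]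
  ring

/-- The first expression is `1 + τ - τ²`, which factors over its roots `(1 ± √5)/2`. -/
theorem golden_bound {τ : ℝ} (h : τ ∈ Ioo (0 : ℝ) ((1 + √5) / 2)) :
    0 ≤ 2 - τ - (τ - 1) ^ 2 ∧ 0 ≤ 2 - τ := by
  have h5 : √5 ^ 2 = 5 := Real.sq_sqrt (by norm_num)
  have h5' : 0 ≤ √5 := Real.sqrt_nonneg 5
  obtain ⟨h0, h1⟩ := h
  have h1s : 1 ≤ √5 := Real.one_le_sqrt.2 (by norm_num)
  have : 0 ≤ 2 - τ - (τ - 1) ^ 2 := by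
    have := mul_nonneg (by linarith : 0 ≤ (1 + √5) / 2 - τ) (by linarith : 0 ≤ τ + (√5 - 1) / 2)
    linarith
  exact ⟨this, by nlinarith [sq_nonneg (τ - 1)]⟩

/-- Descent of the Lyapunov function for step lengths below the golden ratio. -/
theorem IsGenerated.sweep_golden (h : IsGenerated P d u v x) (hd : d.Admissible)
    (hP : P.Compatible d) (hτ : d.τ ∈ Ioo (0 : ℝ) ((1 + √5) / 2)) (k : ℕ)
    {u' : U} (hu : u' ∈ dom P.p) {v' : V} (hv : v' ∈ dom P.q) (x' : X) :
    2 * (gap P d (u (k + 2)) (v (k + 2)) (xTildeSucc d u v x (k + 1)) u' v' x'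
        + P.φ (pair (u (k + 2)) (v (k + 2))) - P.φ (pair u' v'))
      + lyapunov d (baseOp d + d.Q) (u (k + 2)) (v (k + 2)) (x (k + 2)) u' v' x'
      + auxLyapunov d u v (k + 1)
      + (sqNorm d.S (u (k + 2) - u (k + 1)) - d.η * sqNorm d.D₁ (u (k + 2) - u (k + 1))
        + sqNorm d.T (v (k + 2) - v (k + 1)) - d.η * sqNorm d.D₂ (v (k + 2) - v (k + 1)))
      ≤ lyapunov d (baseOp d + d.Q) (u (k + 1)) (v (k + 1)) (x (k + 1)) u' v' x'
        + auxLyapunov d u v k := by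
  have h1 := h.sweep hd hP (k + 1) hu hv x'
  have h2 := h.residual_coupling hd hP k
  simp only [Nat.add_assoc, Nat.reduceAdd] at h1
  have h3 := coupling_identity hd.Q_pos (pair (u (k + 1) - u') (v (k + 1) - v'))
    (pair (u (k + 2) - u') (v (k + 2) - v')) (pair 0 (v (k + 2) - v (k + 1)))
  have h4 := sqNorm_nonneg hd.Q_pos
    (pair (u (k + 1) - u') (v (k + 1) - v') - pair 0 (v (k + 2) - v (k + 1)))
  rw [pair_sub, pair_sub, sub_zero, sub_sub_sub_cancel_right, sub_sub_sub_cancel_right,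
    show v (k + 2) - v' - (v (k + 2) - v (k + 1)) = v (k + 1) - v' by abel] at h3
  -- The old squared residual, stored with weight `2 - τ` in `auxLyapunov`, pays for the weight `(τ
  -- - 1)²` from the coupling.
  have h5 : 0 ≤ (2 - d.τ - (d.τ - 1) ^ 2) * (d.σ * ‖d.res (u (k + 1)) (v (k + 1))‖ ^ 2) :=
    mul_nonneg (golden_bound hτ).1 (mul_nonneg hd.σ_pos.le (sq_nonneg _))
  rw [lyapunov_op_add, lyapunov_op_add, auxLyapunov, auxLyapunov]
  simp only [Nat.add_assoc, Nat.reduceAdd]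
  linarith

/-- Telescoping inequality between the Lyapunov function and the gap `gap + ψ`. -/
def Descends (P : Objective U V) (d : Data U V X) (u : ℕ → U) (v : ℕ → V) (x : ℕ → X)
    (G : WithLp 2 (U × V) →L[ℝ] WithLp 2 (U × V)) (ξ : ℕ → ℝ) (ψ : WithLp 2 (U × V) → ℝ)
    (u' : U) (v' : V) (x' : X) : Prop :=
  ∀ k : ℕ, 2 * (gap P d (u (k + 2)) (v (k + 2)) (xTildeSucc d u v x (k + 1)) u' v' x'
      + ψ (pair (u (k + 2)) (v (k + 2))))
    + lyapunov d G (u (k + 2)) (v (k + 2)) (x (k + 2)) u' v' x' + ξ (k + 1)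
    ≤ lyapunov d G (u (k + 1)) (v (k + 1)) (x (k + 1)) u' v' x' + ξ k

/-- The linearization of `φ` at `w`, without its value. -/
noncomputable def linPart (P : Objective U V) (w : WithLp 2 (U × V)) (w' : WithLp 2 (U × V)) : ℝ :=
  inner ℝ (w' - w) (gradient P.φ w)

theorem sqNorm_M (d : Data U V X) (a : U) (b : V) :
    sqNorm d.M (pair a b) = 1 / 4 * sqNorm d.Q (pair a b)
      + (sqNorm d.S a - d.η * sqNorm d.D₁ a + (sqNorm d.T b - d.η * sqNorm d.D₂ b)) := by
  rw [Data.M, sqNorm_op_add, sqNorm_op_smul, sqNorm_diag, sqNorm_op_sub, sqNorm_op_sub,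
    sqNorm_op_smul, sqNorm_op_smul]

/-- Replacing `φ` by its linearization frees the term `‖ω'‖²_Q`, with `ω'` the new error and `ω` the
old one. Since `¼‖ω' - ω‖²_Q ≤ ½‖ω'‖²_Q + ½‖ω‖²_Q`, it splits into `½‖ω'‖²_Q - ½‖ω‖²_Q`, which
raises the weight of `Q` from `1` to `3/2`, and `¼‖ω' - ω‖²_Q`, which completes the remaining terms
to the form of `M`. -/
theorem IsGenerated.descends_lin_of_caseB (h : IsGenerated P d u v x) (hd : d.Admissible)
    (hP : P.Compatible d) (hB : d.CaseB) {u' : U} (hu : u' ∈ dom P.p) {v' : V}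
    (hv : v' ∈ dom P.q) (x' : X) :
    Descends P d u v x (baseOp d + (3 / 2 : ℝ) • d.Q) (auxLyapunov d u v)
      (linPart P (pair u' v')) u' v' x' := by
  intro k
  have h1 := h.sweep_golden hd hP hB.1 k hu hv x'
  have h2 := hP.φ_lower (pair u' v') (pair (u (k + 2)) (v (k + 2)))
  have h3 := sqNorm_nonneg hB.2.1 (pair (u (k + 2) - u (k + 1)) (v (k + 2) - v (k + 1)))
  rw [sqNorm_M] at h3
  have h4 := sqNorm_nonneg hd.Q_pos (pair (u (k + 2) - u') (v (k + 2) - v')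
    + pair (u (k + 1) - u') (v (k + 1) - v'))
  have h5 := sqNorm_sub hd.Q_pos (pair (u (k + 2) - u') (v (k + 2) - v'))
    (pair (u (k + 1) - u') (v (k + 1) - v'))
  rw [sqNorm_add hd.Q_pos] at h4
  rw [pair_sub, sub_sub_sub_cancel_right, sub_sub_sub_cancel_right] at h5
  rw [pair_sub] at h2
  rw [lyapunov_op_add, sqNorm_op_smul, lyapunov_op_add, sqNorm_op_smul, linPart, pair_sub]
  rw [lyapunov_op_add, lyapunov_op_add] at h1
  linarith

/-- Here `φ` itself stays in the gap and no curvature is left over, so the signs of `S - ηD₁` and `T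
- ηD₂` must suffice. -/
theorem IsGenerated.descends_of_caseB (h : IsGenerated P d u v x) (hd : d.Admissible)
    (hP : P.Compatible d) (hB : d.CaseB) (hS : (d.S - d.η • d.D₁).IsPositive)
    (hT : (d.T - d.η • d.D₂).IsPositive) {u' : U} (hu : u' ∈ dom P.p) {v' : V}
    (hv : v' ∈ dom P.q) (x' : X) :
    Descends P d u v x (baseOp d + d.Q) (auxLyapunov d u v)
      (fun w => P.φ w - P.φ (pair u' v')) u' v' x' := by
  intro k
  have h1 := h.sweep_golden hd hP hB.1 k hu hv x'
  have h2 := sqNorm_nonneg hS (u (k + 2) - u (k + 1))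
  have h3 := sqNorm_nonneg hT (v (k + 2) - v (k + 1))
  rw [sqNorm_op_sub, sqNorm_op_smul] at h2 h3
  linarith

/-- The expression equals `σ‖r - β‖² + (1 - τ)σ‖r‖²`. -/
theorem residual_nonneg {σ τ : ℝ} (hσ : 0 ≤ σ) (hτ : τ ≤ 1) (r β : X) :
    0 ≤ σ * ‖β‖ ^ 2 - 2 * σ * inner ℝ r β + (2 - τ) * σ * ‖r‖ ^ 2 := by
  have h1 : 0 ≤ σ * ‖r - β‖ ^ 2 := mul_nonneg hσ (sq_nonneg _)
  have h2 : 0 ≤ (1 - τ) * (σ * ‖r‖ ^ 2) :=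
    mul_nonneg (by linarith) (mul_nonneg hσ (sq_nonneg _))
  rw [norm_sub_sq_real] at h1
  linarith

/-- Descent of the Lyapunov function for step lengths up to `1`. -/
theorem IsGenerated.sweep_short (h : IsGenerated P d u v x) (hd : d.Admissible)
    (hP : P.Compatible d) (hτ : d.τ ≤ 1) (k : ℕ)
    {u' : U} (hu : u' ∈ dom P.p) {v' : V} (hv : v' ∈ dom P.q) (x' : X) :
    2 * (gap P d (u (k + 1)) (v (k + 1)) (xTildeSucc d u v x k) u' v' x'
        + (P.φ (pair (u (k + 1)) (v (k + 1))) - P.φ (pair u' v')))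
      + lyapunov d (baseOp d) (u (k + 1)) (v (k + 1)) (x (k + 1)) u' v' x'
      ≤ lyapunov d (baseOp d) (u k) (v k) (x k) u' v' x' := by
  have h1 := h.sweep hd hP k hu hv x'
  have h2 := residual_nonneg hd.σ_pos.le hτ (d.res (u (k + 1)) (v (k + 1)))
    (d.B.adjoint (v (k + 1) - v k))
  have h3 := sqNorm_nonneg hd.S_pos (u (k + 1) - u k)
  have h4 := sqNorm_nonneg hd.T_pos (v (k + 1) - v k)
  have h5 := sqNorm_nonneg hd.Q_pos (pair (u (k + 1) - u') (v k - v'))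
  linarith

theorem linPart_le (hP : P.Compatible d) (hd : d.Admissible) (w w' : WithLp 2 (U × V)) :
    linPart P w w' + 1 / 2 * sqNorm d.Q (w' - w) ≤ P.φ w' - P.φ w ∧
      linPart P w w' ≤ P.φ w' - P.φ w := by
  have h1 := hP.φ_lower w w'
  have h2 := sqNorm_nonneg hd.Q_pos (w' - w)
  rw [linPart]
  constructor <;> linarith

theorem res_eq_zero_of_mem_kktSet {z : U × V × X} (hz : z ∈ kktSet P d) :
    d.res z.1 z.2.1 = 0 := by
  rw [Data.res, hz.2, sub_self]

theorem gap_add_linPart_nonneg (hP : P.Compatible d) {z : U × V × X} (hz : z ∈ kktSet P d)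
    {u' : U} (hu : u' ∈ dom P.p) {v' : V} (hv : v' ∈ dom P.q) (x' : X) :
    0 ≤ gap P d u' v' x' z.1 z.2.1 z.2.2 + linPart P (pair z.1 z.2.1) (pair u' v') := by
  have h1 := (kkt_inequality hP hz).2.2 u' hu v' hv
  rw [gap, linPart, res_eq_zero_of_mem_kktSet hz, inner_zero_right]
  linarith

theorem lyapunov_nonneg (hd : d.Admissible) {G : WithLp 2 (U × V) →L[ℝ] WithLp 2 (U × V)}
    (hG : G.IsPositive) (u' : U) (v' : V) (x' : X) (u : U) (v : V) (x : X) :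
    0 ≤ lyapunov d G u' v' x' u v x := by
  have h1 := sqNorm_nonneg hG (pair (u' - u) (v' - v))
  have := hd.σ_pos
  have := hd.τ_pos
  rw [lyapunov]
  positivity

theorem auxLyapunov_nonneg (hd : d.Admissible) (hτ : d.τ ∈ Ioo (0 : ℝ) ((1 + √5) / 2)) (k : ℕ) :
    0 ≤ auxLyapunov d u v k := by
  have h1 := sqNorm_nonneg hd.D₂_pos (v (k + 1) - v k)
  have h2 := sqNorm_nonneg hd.T_pos (v (k + 1) - v k)
  have h3 := mul_nonneg hd.η_mem.1 (sqNorm_nonneg hd.D₁_pos (u (k + 1) - u k))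
  have h4 : 0 ≤ (2 - d.τ) * d.σ * ‖d.res (u (k + 1)) (v (k + 1))‖ ^ 2 :=
    mul_nonneg (mul_nonneg (golden_bound hτ).2 hd.σ_pos.le) (sq_nonneg _)
  rw [auxLyapunov]
  linarith

/-- A bound on the first value of the Lyapunov function in terms of the initial point. -/
theorem IsGenerated.initial_bound (h : IsGenerated P d u v x) (hd : d.Admissible)
    (hP : P.Compatible d) {z : U × V × X} (hz : z ∈ kktSet P d) :
    lyapunov d (baseOp d + (3 / 2 : ℝ) • d.Q) (u 1) (v 1) (x 1) z.1 z.2.1 z.2.2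
        + auxLyapunov d u v 0
      ≤ (14 + 4 * d.τ) * (lyapunov d (baseOp d) (u 0) (v 0) (x 0) z.1 z.2.1 z.2.2
          + 2 / d.σ * ‖x 0 - z.2.2‖ ^ 2)
        + 4 * lyapunov d (baseOp d) (u 0) (v 0) (x 0) z.1 z.2.1 z.2.2
        + 2 / (d.τ * d.σ) * ‖x 0 - z.2.2‖ ^ 2 := by
  have hσ := hd.σ_pos
  have hτ := hd.τ_pos
  obtain ⟨hu, hv, -⟩ := kkt_inequality hP hz
  have hm := h.mem_dom hP 1
  have h1 := h.sweep hd hP 0 hu hv z.2.2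
  have h2 := gap_add_linPart_nonneg hP hz hm.1 hm.2 (xTildeSucc d u v x 0)
  have h3 := (linPart_le hP hd (pair z.1 z.2.1) (pair (u 1) (v 1))).1
  rw [pair_sub] at h3
  rw [lyapunov_op_add, sqNorm_op_smul, auxLyapunov]
  simp only [zero_add] at h1 h2 h3 ⊢
  have hL0 : lyapunov d (baseOp d) (u 0) (v 0) (x 0) z.1 z.2.1 z.2.2
      = lyapunov d (baseOp d) (u 0) (v 0) (x 0) z.1 z.2.1 z.2.2 := rfl
  nth_rewrite 2 [lyapunov] at hL0
  obtain ⟨L0, hL⟩ : ∃ L0, L0 = lyapunov d (baseOp d) (u 0) (v 0) (x 0) z.1 z.2.1 z.2.2 := ⟨_, rfl⟩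
  rw [← hL] at h1 hL0 ⊢
  have hx1 : x 1 = x 0 + (d.τ * d.σ) • d.res (u 1) (v 1) := h.step_x 0
  obtain ⟨r, hr⟩ : ∃ r, r = d.res (u 1) (v 1) := ⟨_, rfl⟩
  rw [← hr] at h1 hx1 ⊢
  obtain ⟨y, hy⟩ : ∃ y, y = x 0 - z.2.2 := ⟨_, rfl⟩
  rw [← hy] at hL0 ⊢
  have ex : x 1 - z.2.2 = y + (d.τ * d.σ) • r := by rw [hx1, hy]; abel
  rw [lyapunov, ex, sqNorm_baseOp] at h1 ⊢
  rw [sqNorm_baseOp] at hL0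
  have e2 : 1 / (d.τ * d.σ) * ‖y + (d.τ * d.σ) • r‖ ^ 2
      = 1 / (d.τ * d.σ) * ‖y‖ ^ 2 + 2 * inner ℝ y r + d.τ * d.σ * ‖r‖ ^ 2 := by
    rw [norm_add_sq_real, norm_smul, inner_smul_right, mul_pow, Real.norm_eq_abs, sq_abs]
    field_simp
  rw [e2] at h1 ⊢
  have hB : 0 ≤ d.σ * ‖d.B.adjoint (v 1 - v 0) - r‖ ^ 2 := by positivity
  rw [norm_sub_sq_real, real_inner_comm] at hB
  -- The `τσ‖r‖²` from the multiplier error restores the sweep's weight `2 - τ` on `σ‖r‖²` to `2`,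
  -- of which the completed square in `hB` uses one. So `σ‖r‖²` remains for every `τ`; half of it
  -- absorbs the cross term with the initial multiplier error.
  have hyr : |2 * inner ℝ y r| ≤ d.σ / 2 * ‖r‖ ^ 2 + 2 / d.σ * ‖y‖ ^ 2 := by
    rw [abs_mul, abs_two]
    have ha := abs_real_inner_le_norm y r
    have hb : 0 ≤ d.σ / 2 * (‖r‖ - 2 / d.σ * ‖y‖) ^ 2 := by positivity
    have hc : d.σ / 2 * (‖r‖ - 2 / d.σ * ‖y‖) ^ 2
        = d.σ / 2 * ‖r‖ ^ 2 - 2 * (‖y‖ * ‖r‖) + 2 / d.σ * ‖y‖ ^ 2 := by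
      field_simp
      ring
    linarith
  have hyr' := abs_le.1 hyr
  have y1 : 0 ≤ 1 / (d.τ * d.σ) * ‖y‖ ^ 2 := by positivity
  have y2 : 2 / (d.τ * d.σ) * ‖y‖ ^ 2 = 2 * (1 / (d.τ * d.σ) * ‖y‖ ^ 2) := by ring
  have y3 : 0 ≤ 2 / d.σ * ‖y‖ ^ 2 := by positivity
  have rr : 0 ≤ d.σ * ‖r‖ ^ 2 := by positivity
  have p1 := sqNorm_nonneg hd.D₁_pos (u 1 - z.1)
  have p2 := sqNorm_nonneg hd.S_pos (u 1 - z.1)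
  have p3 := sqNorm_nonneg hd.Q_pos (pair 0 (v 1 - z.2.1))
  have p4 := sqNorm_nonneg hd.D₂_pos (v 1 - z.2.1)
  have p5 := sqNorm_nonneg hd.T_pos (v 1 - z.2.1)
  have p6 : 0 ≤ d.σ * ‖d.res z.1 (v 1)‖ ^ 2 := by positivity
  have p7 := sqNorm_nonneg hd.Q_pos (pair (u 1 - z.1) (v 1 - z.2.1))
  have p8 := sqNorm_nonneg hd.Q_pos (pair (u 1 - z.1) (v 0 - z.2.1))
  have p9 := sqNorm_nonneg hd.S_pos (u 1 - u 0)
  have p10 := sqNorm_nonneg hd.T_pos (v 1 - v 0)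
  have q1 := sqNorm_nonneg hd.D₁_pos (u 0 - z.1)
  have q2 := sqNorm_nonneg hd.S_pos (u 0 - z.1)
  have q3 := sqNorm_nonneg hd.Q_pos (pair 0 (v 0 - z.2.1))
  have q4 := sqNorm_nonneg hd.D₂_pos (v 0 - z.2.1)
  have q5 := sqNorm_nonneg hd.T_pos (v 0 - z.2.1)
  have q6 : 0 ≤ d.σ * ‖d.res z.1 (v 0)‖ ^ 2 := by positivity
  have s1 := sqNorm_add_le hd.D₁_pos (u 1 - z.1) (-(u 0 - z.1))
  have s2 := sqNorm_add_le hd.D₂_pos (v 1 - z.2.1) (-(v 0 - z.2.1))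
  rw [sqNorm_neg, ← sub_eq_add_neg, sub_sub_sub_cancel_right] at s1 s2
  have s3 : d.η * sqNorm d.D₁ (u 1 - u 0) ≤ sqNorm d.D₁ (u 1 - u 0) :=
    mul_le_of_le_one_left (sqNorm_nonneg hd.D₁_pos _) hd.η_mem.2
  -- The gap at a KKT point, with `φ` itself, is at least half the squared `Q`-error; hence the
  -- first summand.
  have C1 : sqNorm d.Q (pair (u 1 - z.1) (v 1 - z.2.1)) + sqNorm d.D₁ (u 1 - z.1)
      + sqNorm d.S (u 1 - z.1) + (sqNorm d.Q (pair 0 (v 1 - z.2.1)) + sqNorm d.D₂ (v 1 - z.2.1)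
      + sqNorm d.T (v 1 - z.2.1)) + d.σ * ‖d.res z.1 (v 1)‖ ^ 2 + sqNorm d.T (v 1 - v 0)
      + d.σ / 2 * ‖r‖ ^ 2 ≤ L0 + 2 / d.σ * ‖y‖ ^ 2 := by linarith
  have hrτ : d.τ * d.σ * ‖r‖ ^ 2 ≤ 2 * d.τ * (L0 + 2 / d.σ * ‖y‖ ^ 2) := by
    have : d.σ / 2 * ‖r‖ ^ 2 ≤ L0 + 2 / d.σ * ‖y‖ ^ 2 := by linarith
    nlinarith
  have hr2 : d.τ * (d.σ * ‖r‖ ^ 2) = d.τ * d.σ * ‖r‖ ^ 2 := by ring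
  have hτC : 0 ≤ d.τ * (d.σ * ‖r‖ ^ 2) := by positivity
  linarith

end Descent
-- Ergodic averages: telescoping, convexity, uniform bounds.
section Ergodic

variable {U V X : Type*}
variable [NormedAddCommGroup U] [InnerProductSpace ℝ U] [FiniteDimensional ℝ U]
variable [NormedAddCommGroup V] [InnerProductSpace ℝ V] [FiniteDimensional ℝ V]
variable [NormedAddCommGroup X] [InnerProductSpace ℝ X] [FiniteDimensional ℝ X]
variable {P : Objective U V} {d : Data U V X}
variable {u : ℕ → U} {v : ℕ → V} {x : ℕ → X}

theorem average_pair (y : ℕ → U) (z : ℕ → V) (k : ℕ) :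
    average (fun i => pair (y i) (z i)) k = pair (average y k) (average z k) := by
  have : ∑ i ∈ Finset.Icc 1 k, pair (y i) (z i)
      = pair (∑ i ∈ Finset.Icc 1 k, y i) (∑ i ∈ Finset.Icc 1 k, z i) := by
    induction Finset.Icc 1 k using Finset.induction_on with
    | empty => rfl
    | insert a s ha ih => rw [Finset.sum_insert ha, Finset.sum_insert ha, Finset.sum_insert ha, ih,
        pair_add]
  rw [average, this, pair_smul]
  rfl

theorem average_add {E : Type*} [AddCommGroup E] [Module ℝ E] (y z : ℕ → E) (k : ℕ) :
    average (fun i => y i + z i) k = average y k + average z k := by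
  simp [average, Finset.sum_add_distrib]

theorem norm_average_sub_le {E : Type*} [NormedAddCommGroup E] [InnerProductSpace ℝ E]
    {y : ℕ → E} {c : E} {r : ℝ} (h : ∀ i, 1 ≤ i → ‖y i - c‖ ≤ r) {k : ℕ} (hk : 1 ≤ k) :
    ‖average y k - c‖ ≤ r := by
  rw [← average_const_sub y c hk]
  have h1 : ∀ i, 1 ≤ i → y i - c ∈ Metric.closedBall (0 : E) r := by
    intro i hi
    simpa using h i hi
  -- The zero function is a dummy: only the membership of the average in a convex set is wanted.
  have := (average_le_of_convexOn (f := fun _ => (0 : ℝ))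
    (convexOn_const 0 (convex_closedBall (0 : E) r)) h1 hk).1
  simpa using this

theorem sqNorm_average_sub_le {E : Type*} [NormedAddCommGroup E] [InnerProductSpace ℝ E]
    {G : E →L[ℝ] E} (hG : G.IsPositive) {y : ℕ → E} {c : E} {r : ℝ}
    (h : ∀ i, 1 ≤ i → sqNorm G (y i - c) ≤ r) {k : ℕ} (hk : 1 ≤ k) :
    sqNorm G (average y k - c) ≤ r := by
  rw [← average_const_sub y c hk]
  have hc : ConvexOn ℝ {z | z ∈ (univ : Set E) ∧ sqNorm G z ≤ r} (fun _ => (0 : ℝ)) :=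
    convexOn_const 0 ((convexOn_sqNorm hG).convex_le r)
  exact (average_le_of_convexOn hc (fun i hi => ⟨mem_univ _, h i hi⟩) hk).1.2

theorem res_average (d : Data U V X) (y : ℕ → U) (z : ℕ → V) {k : ℕ} (hk : 1 ≤ k) :
    d.res (average y k) (average z k) = average (fun i => d.res (y i) (z i)) k := by
  simp only [Data.res]
  rw [average_const_sub _ d.c hk, average_add, average_map, average_map]

/-- The averaged residual telescopes. -/
theorem IsGenerated.res_avgShift (h : IsGenerated P d u v x) (hd : d.Admissible) {k : ℕ}
    (hk : 1 ≤ k) :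
    d.res (avgShift u k) (avgShift v k) = (1 / (k * (d.τ * d.σ))) • (x (k + 1) - x 1) := by
  have hτ := hd.τ_pos.ne'
  have hσ := hd.σ_pos.ne'
  have hsum : ∀ n : ℕ, (d.τ * d.σ) • ∑ i ∈ Finset.Icc 1 n, d.res (u (i + 1)) (v (i + 1))
      = x (n + 1) - x 1 := by
    intro n
    induction n with
    | zero => simp
    | succ n ih =>
      rw [Finset.sum_Icc_succ_top (by omega), smul_add, ih, h.step_x (n + 1)]
      abel
  rw [avgShift, avgShift, res_average d _ _ hk, average, ← hsum k, smul_smul]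
  congr 1
  field_simp

/-- Bounds on the multipliers thus carry over to the auxiliary multipliers and their averages. -/
theorem xTildeSucc_eq (h : IsGenerated P d u v x) (hd : d.Admissible) (k : ℕ) :
    xTildeSucc d u v x k = x k + (1 / d.τ) • (x (k + 1) - x k) := by
  have := hd.τ_pos.ne'
  rw [xTildeSucc, h.step_x k, add_sub_cancel_left, smul_smul]
  congr 2
  field_simp

theorem gap_average (hP : P.Compatible d) {y : ℕ → U} {z : ℕ → V} {t : ℕ → X}
    (hy : ∀ i, 1 ≤ i → y i ∈ dom P.p) (hz : ∀ i, 1 ≤ i → z i ∈ dom P.q)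
    {ψ : WithLp 2 (U × V) → ℝ} (hψ : ConvexOn ℝ univ ψ) (u' : U) (v' : V) (x' : X) {k : ℕ}
    (hk : 1 ≤ k) :
    gap P d (average y k) (average z k) (average t k) u' v' x'
        + ψ (pair (average y k) (average z k))
      ≤ 1 / (k : ℝ) * ∑ i ∈ Finset.Icc 1 k, (gap P d (y i) (z i) (t i) u' v' x'
        + ψ (pair (y i) (z i))) := by
  have hk' : (k : ℝ) ≠ 0 := by positivity
  have h1 := (average_le_of_convexOn hP.convexOn_pr hy hk).2
  have h2 := (average_le_of_convexOn hP.convexOn_qr hz hk).2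
  have h3 := (average_le_of_convexOn hψ (y := fun i => pair (y i) (z i))
    (fun i _ => mem_univ _) hk).2
  rw [average_pair] at h3
  have h4 : inner ℝ x' (average (fun i => d.res (y i) (z i)) k)
      = 1 / (k : ℝ) * ∑ i ∈ Finset.Icc 1 k, inner ℝ x' (d.res (y i) (z i)) := by
    rw [average, real_inner_smul_right, inner_sum]
  have h5 : inner ℝ (average t k) (d.res u' v')
      = 1 / (k : ℝ) * ∑ i ∈ Finset.Icc 1 k, inner ℝ (t i) (d.res u' v') := by
    rw [average, real_inner_smul_left, sum_inner]
  have h6 : ∀ s : ℝ, 1 / (k : ℝ) * ∑ i ∈ Finset.Icc 1 k, s = s := by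
    intro s
    simp [hk']
  simp only [gap, Finset.sum_add_distrib, Finset.sum_sub_distrib, mul_add, mul_sub, h6]
  rw [res_average d _ _ hk, h4, h5]
  linarith

/-- The descent inequalities telescope, the final Lyapunov value is nonnegative, and the gap plus
`ψ` is convex in the iterate. The sum starts at the first iterate because `ξ` may involve two
consecutive iterates. -/
theorem Descends.ergodic {G : WithLp 2 (U × V) →L[ℝ] WithLp 2 (U × V)} {ξ : ℕ → ℝ}
    {ψ : WithLp 2 (U × V) → ℝ} {u' : U} {v' : V} {x' : X}
    (hD : Descends P d u v x G ξ ψ u' v' x') (h : IsGenerated P d u v x) (hd : d.Admissible)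
    (hP : P.Compatible d) (hG : G.IsPositive) (hξ : ∀ k, 0 ≤ ξ k) (hψ : ConvexOn ℝ univ ψ)
    {k : ℕ} (hk : 1 ≤ k) :
    gap P d (avgShift u k) (avgShift v k) (xHat d u v x k) u' v' x'
        + ψ (pair (avgShift u k) (avgShift v k))
      ≤ (lyapunov d G (u 1) (v 1) (x 1) u' v' x' + ξ 0) / (2 * k) := by
  have hk' : (0 : ℝ) < k := by exact_mod_cast hk
  have hsum : ∀ n : ℕ, 2 * ∑ i ∈ Finset.Icc 1 n,
      (gap P d (u (i + 1)) (v (i + 1)) (xTildeSucc d u v x i) u' v' x'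
        + ψ (pair (u (i + 1)) (v (i + 1))))
      + lyapunov d G (u (n + 1)) (v (n + 1)) (x (n + 1)) u' v' x' + ξ n
      ≤ lyapunov d G (u 1) (v 1) (x 1) u' v' x' + ξ 0 := by
    intro n
    induction n with
    | zero => simp
    | succ n ih =>
      rw [Finset.sum_Icc_succ_top (by omega)]
      have := hD n
      linarith
  have h1 := gap_average hP (y := fun i => u (i + 1)) (z := fun i => v (i + 1))
    (t := xTildeSucc d u v x) (fun i _ => (h.mem_dom hP (i + 1)).1)
    (fun i _ => (h.mem_dom hP (i + 1)).2) hψ u' v' x' hk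
  have h2 := hsum k
  have h3 := lyapunov_nonneg hd hG (u (k + 1)) (v (k + 1)) (x (k + 1)) u' v' x'
  have h4 := hξ k
  refine h1.trans ?_
  rw [one_div_mul_eq_div, div_le_div_iff₀ hk' (by positivity)]
  nlinarith

/-- At a KKT point the gap is nonnegative, so the Lyapunov function is nonincreasing. -/
theorem Descends.bounded {G : WithLp 2 (U × V) →L[ℝ] WithLp 2 (U × V)} {ξ : ℕ → ℝ}
    {z : U × V × X} (hD : Descends P d u v x G ξ (linPart P (pair z.1 z.2.1)) z.1 z.2.1 z.2.2)
    (h : IsGenerated P d u v x) (hP : P.Compatible d) (hz : z ∈ kktSet P d) (k : ℕ) :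
    lyapunov d G (u (k + 1)) (v (k + 1)) (x (k + 1)) z.1 z.2.1 z.2.2 + ξ k
      ≤ lyapunov d G (u 1) (v 1) (x 1) z.1 z.2.1 z.2.2 + ξ 0 := by
  induction k with
  | zero => simp
  | succ k ih =>
    have h1 := hD k
    have hm := h.mem_dom hP (k + 2)
    have h2 := gap_add_linPart_nonneg hP hz hm.1 hm.2 (xTildeSucc d u v x (k + 1))
    linarith

/-- Uniform bounds for the ergodic averages of sequences with a bounded Lyapunov function. -/
theorem exists_uniform_bounds (hd : d.Admissible)
    {G : WithLp 2 (U × V) →L[ℝ] WithLp 2 (U × V)} (hG : G.IsPositive) (z : U × V × X)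
    (C : ℝ) : ∃ K₁ K₂ : ℝ, ∀ (P : Objective U V)
      (u : ℕ → U) (v : ℕ → V) (x : ℕ → X), IsGenerated P d u v x →
      (∀ k, lyapunov d G (u (k + 1)) (v (k + 1)) (x (k + 1)) z.1 z.2.1 z.2.2 ≤ C) →
      ∀ k : ℕ, 1 ≤ k → ‖d.res (avgShift u k) (avgShift v k)‖ ≤ K₁ / k ∧
        ∀ (u' : U) (v' : V) (x' : X), ‖u' - avgShift u k‖ ^ 2 + ‖v' - avgShift v k‖ ^ 2
          + ‖x' - xHat d u v x k‖ ^ 2 ≤ 1 → lyapunov d G (u 1) (v 1) (x 1) u' v' x' ≤ K₂ := by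
  have hσ := hd.σ_pos
  have hτ := hd.τ_pos
  -- For iterates from index `1` on, `ρ` bounds the multiplier error and `β` the residual with `u`
  -- replaced by its KKT value. No definiteness of `G` is used: it enters as a seminorm.
  set ρ : ℝ := √(d.τ * d.σ * C)
  set β : ℝ := √(C / d.σ)
  set K₁ : ℝ := 1 / (d.τ * d.σ) * (2 * ρ)
  refine ⟨K₁, 2 * (C + 2 * (C + ‖G‖)) + d.σ * (K₁ + ‖d.A.adjoint‖ + 2 * β) ^ 2
    + 1 / (d.τ * d.σ) * (ρ + (ρ + 1 / d.τ * (2 * ρ)) + 1) ^ 2, fun P u v x h hC k hk => ?_⟩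
  obtain ⟨ub, vb, xb⟩ := z
  simp only at hC
  have hk' : (0 : ℝ) < k := by exact_mod_cast hk
  have hk1 : (1 : ℝ) ≤ k := by exact_mod_cast hk
  have bw : ∀ i, 1 ≤ i → sqNorm G (pair (u i) (v i) - pair ub vb) ≤ C ∧
      ‖d.res ub (v i) - 0‖ ≤ β ∧ ‖x i - xb‖ ≤ ρ := by
    intro i hi
    obtain ⟨j, rfl⟩ : ∃ j, i = j + 1 := ⟨i - 1, by omega⟩
    have h0 := hC j
    have h1 := sqNorm_nonneg hG (pair (u (j + 1) - ub) (v (j + 1) - vb))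
    have h2 : 0 ≤ d.σ * ‖d.res ub (v (j + 1))‖ ^ 2 := by positivity
    have h3 : 0 ≤ 1 / (d.τ * d.σ) * ‖x (j + 1) - xb‖ ^ 2 := by positivity
    rw [lyapunov] at h0
    refine ⟨by rw [pair_sub]; linarith, ?_, ?_⟩
    · rw [sub_zero]
      refine Real.le_sqrt_of_sq_le ?_
      rw [le_div_iff₀ hσ]
      linarith
    · refine Real.le_sqrt_of_sq_le ?_
      have h4 : 1 / (d.τ * d.σ) * ‖x (j + 1) - xb‖ ^ 2 ≤ C := by linarith
      rw [one_div_mul_eq_div, div_le_iff₀ (by positivity)] at h4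
      linarith
  have hxx : ∀ i, 1 ≤ i → ‖x (i + 1) - x i‖ ≤ 2 * ρ := by
    intro i hi
    have h1 := (bw i hi).2.2
    have h2 := (bw (i + 1) (by omega)).2.2
    have := norm_sub_le (x (i + 1) - xb) (x i - xb)
    rw [sub_sub_sub_cancel_right] at this
    linarith
  have hres : ‖d.res (avgShift u k) (avgShift v k)‖ ≤ K₁ / k := by
    have hd0 : ‖x (k + 1) - x 1‖ ≤ 2 * ρ := by
      have h1 := (bw 1 le_rfl).2.2
      have h2 := (bw (k + 1) (by omega)).2.2
      have := norm_sub_le (x (k + 1) - xb) (x 1 - xb)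
      rw [sub_sub_sub_cancel_right] at this
      linarith
    rw [h.res_avgShift hd hk, norm_smul, Real.norm_of_nonneg (by positivity)]
    calc 1 / (k * (d.τ * d.σ)) * ‖x (k + 1) - x 1‖
        ≤ 1 / (k * (d.τ * d.σ)) * (2 * ρ) := by gcongr
      _ = K₁ / k := by simp only [K₁]; field_simp
  have hρ : 0 ≤ ρ := Real.sqrt_nonneg _
  have hβ : 0 ≤ β := Real.sqrt_nonneg _
  have hK₁ : 0 ≤ K₁ := by positivity
  refine ⟨hres, fun u' v' x' hb => ?_⟩
  have n1 := sq_nonneg (‖u' - avgShift u k‖)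
  have n2 := sq_nonneg (‖v' - avgShift v k‖)
  have n3 := sq_nonneg (‖x' - xHat d u v x k‖)
  have hb1 : ‖u' - avgShift u k‖ ≤ 1 := (sq_le_one_iff₀ (norm_nonneg _)).1 (by linarith)
  have hb2 : ‖x' - xHat d u v x k‖ ≤ 1 := (sq_le_one_iff₀ (norm_nonneg _)).1 (by linarith)
  have hb3 : ‖pair (avgShift u k) (avgShift v k) - pair u' v'‖ ^ 2 ≤ 1 := by
    rw [pair_sub, norm_pair_sq, norm_sub_rev _ u', norm_sub_rev _ v']
    linarith
  have aw : sqNorm G (pair (avgShift u k) (avgShift v k) - pair ub vb) ≤ C := by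
    have := sqNorm_average_sub_le hG (y := fun i => pair (u (i + 1)) (v (i + 1)))
      (c := pair ub vb) (fun i _ => (bw (i + 1) (by omega)).1) hk
    rw [average_pair] at this
    exact this
  have av : ‖d.res ub (avgShift v k)‖ ≤ β := by
    have h1 := norm_average_sub_le (fun i (_ : 1 ≤ i) => (bw (i + 1) (by omega)).2.1) hk
    have h2 := res_average d (fun _ => ub) (fun i => v (i + 1)) hk
    have h3 : average (fun _ : ℕ => ub) k = ub := by
      simp [average, ← Nat.cast_smul_eq_nsmul ℝ, smul_smul, hk'.ne']
    rw [h3] at h2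
    rw [← h2, sub_zero] at h1
    exact h1
  have ax : ‖xHat d u v x k - xb‖ ≤ ρ + 1 / d.τ * (2 * ρ) := by
    refine norm_average_sub_le (fun i hi => ?_) hk
    rw [xTildeSucc_eq h hd, add_sub_right_comm]
    refine (norm_add_le _ _).trans (add_le_add (bw i hi).2.2 ?_)
    rw [norm_smul, Real.norm_of_nonneg (by positivity)]
    exact mul_le_mul_of_nonneg_left (hxx i hi) (by positivity)
  have f1 : sqNorm G (pair (u 1 - u') (v 1 - v')) ≤ 2 * (C + 2 * (C + ‖G‖)) := by
    have e : pair (u 1 - u') (v 1 - v') = (pair (u 1) (v 1) - pair ub vb)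
        + (-(pair (avgShift u k) (avgShift v k) - pair ub vb)
          + (pair (avgShift u k) (avgShift v k) - pair u' v')) := by
      rw [← pair_sub]; abel
    have g1 := sqNorm_add_le hG (pair (u 1) (v 1) - pair ub vb)
      (-(pair (avgShift u k) (avgShift v k) - pair ub vb)
          + (pair (avgShift u k) (avgShift v k) - pair u' v'))
    have g2 := sqNorm_add_le hG (-(pair (avgShift u k) (avgShift v k) - pair ub vb))
      (pair (avgShift u k) (avgShift v k) - pair u' v')
    have g3 := sqNorm_le G (pair (avgShift u k) (avgShift v k) - pair u' v')
    have g4 : ‖G‖ * ‖pair (avgShift u k) (avgShift v k) - pair u' v'‖ ^ 2 ≤ ‖G‖ :=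
      mul_le_of_le_one_right G.opNorm_nonneg hb3
    rw [sqNorm_neg] at g2
    have g5 := (bw 1 le_rfl).1
    rw [e]
    linarith
  -- The seminorm does not control this residual, so it is compared with the averaged one: `u'` is
  -- within distance `1` of the average, and the change in `v` is measured by residuals at the KKT
  -- value of `u`.
  have f2 : ‖d.res u' (v 1)‖ ≤ K₁ + ‖d.A.adjoint‖ + 2 * β := by
    have e : d.res u' (v 1) = d.res (avgShift u k) (avgShift v k)
        + d.A.adjoint (u' - avgShift u k) + (d.res ub (v 1) - d.res ub (avgShift v k)) := by
      simp only [Data.res, map_sub]; abel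
    have g1 : ‖d.A.adjoint (u' - avgShift u k)‖ ≤ ‖d.A.adjoint‖ :=
      (d.A.adjoint.le_opNorm _).trans (mul_le_of_le_one_right (norm_nonneg _) hb1)
    have g2 : ‖d.res ub (v 1) - d.res ub (avgShift v k)‖ ≤ β + β := by
      refine (norm_sub_le _ _).trans (add_le_add ?_ av)
      simpa using (bw 1 le_rfl).2.1
    have g3 : K₁ / k ≤ K₁ := div_le_self hK₁ hk1
    rw [e]
    refine (norm_add₃_le).trans ?_
    linarith
  have f3 : ‖x 1 - x'‖ ≤ ρ + (ρ + 1 / d.τ * (2 * ρ)) + 1 := by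
    have e : x 1 - x' = (x 1 - xb) - (xHat d u v x k - xb) - (x' - xHat d u v x k) := by abel
    rw [e]
    refine (norm_sub_le _ _).trans (add_le_add ((norm_sub_le _ _).trans ?_) hb2)
    exact add_le_add (bw 1 le_rfl).2.2 ax
  rw [lyapunov]
  gcongr

end Ergodic

/-! ### Assembly of the two cases and translation to the extended-valued statement. -/

section Main

variable {U V X : Type*}
variable [NormedAddCommGroup U] [InnerProductSpace ℝ U] [FiniteDimensional ℝ U]
variable [NormedAddCommGroup V] [InnerProductSpace ℝ V] [FiniteDimensional ℝ V]
variable [NormedAddCommGroup X] [InnerProductSpace ℝ X] [FiniteDimensional ℝ X]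
variable {d : Data U V X}

/-- The descent property of the method in either case, with a bound on the first value of the
Lyapunov function that depends on the initial point and one KKT point only. -/
theorem exists_descent (hd : d.Admissible) (hcase : d.CaseA ∨ d.CaseB) (u₀ : U) (v₀ : V) (x₀ : X)
    (z : U × V × X) :
    ∃ (C : ℝ) (G : WithLp 2 (U × V) →L[ℝ] WithLp 2 (U × V)), G.IsPositive ∧
      ∀ P : Objective U V, P.Compatible d → z ∈ kktSet P d →
      ∀ (u : ℕ → U) (v : ℕ → V) (x : ℕ → X), IsGenerated P d u v x →
      u 0 = u₀ → v 0 = v₀ → x 0 = x₀ → ∃ ξ : ℕ → ℝ, (∀ k, 0 ≤ ξ k) ∧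
        lyapunov d G (u 1) (v 1) (x 1) z.1 z.2.1 z.2.2 + ξ 0 ≤ C ∧
        (∀ u' ∈ dom P.p, ∀ v' ∈ dom P.q, ∀ x' : X,
          Descends P d u v x G ξ (linPart P (pair u' v')) u' v' x') ∧
        (d.CaseA ∨ (d.CaseB ∧ (d.S - d.η • d.D₁).IsPositive ∧ (d.T - d.η • d.D₂).IsPositive) →
          ∃ G' : WithLp 2 (U × V) →L[ℝ] WithLp 2 (U × V), G'.IsPositive ∧
            lyapunov d G' (u 1) (v 1) (x 1) z.1 z.2.1 z.2.2 + ξ 0 ≤ C ∧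
            Descends P d u v x G' ξ (fun w => P.φ w - P.φ (pair z.1 z.2.1)) z.1 z.2.1 z.2.2) := by
  by_cases hA : d.CaseA
  -- Descent holds already from the initial point, so its Lyapunov value is the bound, `ξ` is zero,
  -- and the same operator serves both gaps.
  · refine ⟨lyapunov d (baseOp d) u₀ v₀ x₀ z.1 z.2.1 z.2.2, baseOp d, hd.baseOp_pos,
      fun P hP hz u v x h hu hv hx => ⟨fun _ => 0, fun _ => le_rfl, ?_, ?_, fun _ =>
        ⟨baseOp d, hd.baseOp_pos, ?_⟩⟩⟩
    all_goals
      obtain ⟨hzu, hzv, -⟩ := kkt_inequality hP hz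
      have hm := h.mem_dom hP 1
      have h1 := h.sweep_short hd hP hA.1.2 0 hzu hzv z.2.2
      have h2 := gap_add_linPart_nonneg hP hz hm.1 hm.2 (xTildeSucc d u v x 0)
      have h3 := (linPart_le hP hd (pair z.1 z.2.1) (pair (u 1) (v 1))).2
      simp only [zero_add] at h1
      rw [hu, hv, hx] at h1
    · linarith
    · intro u' hu' v' hv' x' k
      have h4 := h.sweep_short hd hP hA.1.2 (k + 1) hu' hv' x'
      have h5 := (linPart_le hP hd (pair u' v') (pair (u (k + 2)) (v (k + 2)))).2
      simp only [Nat.add_assoc, Nat.reduceAdd] at h4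
      linarith
    · refine ⟨by linarith, fun k => ?_⟩
      have h4 := h.sweep_short hd hP hA.1.2 (k + 1) hzu hzv z.2.2
      simp only [Nat.add_assoc, Nat.reduceAdd] at h4
      linarith
  · have hB := hcase.resolve_left hA
    have hQ' : ((3 / 2 : ℝ) • d.Q).IsPositive :=
      isPositive_mk (fun a b => by
        simp only [smul_apply, real_inner_smul_right, inner_symm_of_isPositive hd.Q_pos a])
        (fun a => by
          rw [sqNorm_op_smul]
          exact mul_nonneg (by norm_num) (sqNorm_nonneg hd.Q_pos a))
    refine ⟨(14 + 4 * d.τ) * (lyapunov d (baseOp d) u₀ v₀ x₀ z.1 z.2.1 z.2.2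
          + 2 / d.σ * ‖x₀ - z.2.2‖ ^ 2)
        + 4 * lyapunov d (baseOp d) u₀ v₀ x₀ z.1 z.2.1 z.2.2
        + 2 / (d.τ * d.σ) * ‖x₀ - z.2.2‖ ^ 2, baseOp d + (3 / 2 : ℝ) • d.Q,
      hd.baseOp_pos.add hQ', fun P hP hz u v x h hu hv hx => ⟨auxLyapunov d u v,
        auxLyapunov_nonneg hd hB.1, ?_, fun u' hu' v' hv' x' =>
          h.descends_lin_of_caseB hd hP hB hu' hv' x', fun hex =>
          ⟨baseOp d + d.Q, hd.baseOp_pos.add hd.Q_pos, ?_, ?_⟩⟩⟩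
    all_goals
      have h1 := h.initial_bound hd hP hz
      rw [hu, hv, hx] at h1
    · exact h1
    -- The operator for the objective gap is the smaller one, so the same bound holds.
    · have h2 := sqNorm_nonneg hd.Q_pos (pair (u 1 - z.1) (v 1 - z.2.1))
      rw [lyapunov_op_add, sqNorm_op_smul] at h1
      rw [lyapunov_op_add]
      linarith
    · obtain ⟨hzu, hzv, -⟩ := kkt_inequality hP hz
      obtain ⟨-, hS, hT⟩ := hex.resolve_left hA
      exact h.descends_of_caseB hd hP hB hS hT hzu hzv _

theorem convexOn_linPart (P : Objective U V) (w : WithLp 2 (U × V)) :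
    ConvexOn ℝ univ (linPart P w) := by
  refine ⟨convex_univ, fun a _ b _ s t _ _ hst => le_of_eq ?_⟩
  have e : s • a + t • b - w = s • (a - w) + t • (b - w) := by
    have : w = (s + t) • w := by rw [hst, one_smul]
    nth_rewrite 1 [this]
    module
  rw [linPart, e, inner_add_left, real_inner_smul_left, real_inner_smul_left]
  rfl

/-- Off the domain the right-hand side is `⊤`. On it, the difference of the residuals at the two
points is linear, and moving the adjoints across turns the gap into the required form. -/
theorem isApproxSolution_of_gap {P : Objective U V} (hP : P.Compatible d) {ε : ℝ} {ut : U}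
    {vt : V} {xt : X} (hu : ut ∈ dom P.p) (hv : vt ∈ dom P.q)
    (h : ∀ u ∈ dom P.p, ∀ v ∈ dom P.q, ∀ x : X,
      ‖u - ut‖ ^ 2 + ‖v - vt‖ ^ 2 + ‖x - xt‖ ^ 2 ≤ 1 →
      gap P d ut vt xt u v x + linPart P (pair u v) (pair ut vt) ≤ ε) :
    IsApproxSolution P d ε ut vt xt := by
  intro u v x hb
  by_cases hu' : u ∈ dom P.p
  · by_cases hv' : v ∈ dom P.q
    · have h1 := h u hu' v hv' x hb
      rw [← hP.coe_pr hu, ← hP.coe_qr hv, ← hP.coe_pr hu', ← hP.coe_qr hv']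
      have e : d.res ut vt = d.A.adjoint (ut - u) + d.B.adjoint (vt - v) + d.res u v := by
        simp only [Data.res, map_sub]; abel
      rw [gap, linPart, e, inner_add_right, inner_add_right,
        ContinuousLinearMap.adjoint_inner_right, ContinuousLinearMap.adjoint_inner_right,
        real_inner_comm (ut - u), real_inner_comm (vt - v)] at h1
      rw [inner_sub_left xt]
      norm_cast
      linarith
    · have : P.q v = ⊤ := not_not.1 hv'
      rw [this, EReal.add_top_of_ne_bot (hP.p_convex.ne_bot u), EReal.top_add_coe]
      exact le_top
  · have : P.p u = ⊤ := not_not.1 hu'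
    rw [this, EReal.top_add_of_ne_bot (hP.q_convex.ne_bot v), EReal.top_add_coe]
    exact le_top

/-- KKT points attain the optimal value, so the single chosen KKT point represents every optimal
solution in (iii). -/
theorem θr_eq_of_isSolution {P : Objective U V} (hP : P.Compatible d) (hd : d.Admissible)
    {z : U × V × X} (hz : z ∈ kktSet P d) {u : U} {v : V} (hs : IsSolution P d u v) :
    P.θr u v = P.θr z.1 z.2.1 := by
  obtain ⟨hzu, hzv, hk⟩ := kkt_inequality hP hz
  refine le_antisymm ?_ ?_
  · have := hs.optimal z.1 z.2.1 hz.2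
    rw [hP.coe_θr hs.mem_dom.1 hs.mem_dom.2, hP.coe_θr hzu hzv] at this
    exact_mod_cast this
  · have h1 := hk u hs.mem_dom.1 v hs.mem_dom.2
    have h2 := (linPart_le hP hd (pair z.1 z.2.1) (pair u v)).2
    rw [Data.res, hs.feasible, sub_self, inner_zero_right] at h1
    simp only [linPart] at h2
    simp only [Objective.θr]
    linarith

end Main
end MajADMM

theorem theorem4p3
    {U V X : Type*}
    [NormedAddCommGroup U] [InnerProductSpace ℝ U] [FiniteDimensional ℝ U]
    [NormedAddCommGroup V] [InnerProductSpace ℝ V] [FiniteDimensional ℝ V]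
    [NormedAddCommGroup X] [InnerProductSpace ℝ X] [FiniteDimensional ℝ X]
    (d : MajADMM.Data U V X) (hd : d.Admissible)
    (hprox : d.ProxCondition)
    (hcase : d.CaseA ∨ d.CaseB)
    -- the initial point, and the set of optimal solutions with their multipliers
    (u₀ : U) (v₀ : V) (x₀ : X) (Z : Set (U × V × X)) :
    -- the constants depend on the initial point and the optimal solution set, but on the objective
    -- and on the iterates only through these
    ∃ C₁ C₂ C₃ : ℝ, ∀ P : MajADMM.Objective U V, P.Compatible d →
      (∃ u v, MajADMM.IsSolution P d u v) →
      MajADMM.ConstraintQualification P d →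
      MajADMM.kktSet P d = Z →
      ∀ (u : ℕ → U) (v : ℕ → V) (x : ℕ → X), MajADMM.IsGenerated P d u v x →
        u 0 = u₀ → v 0 = v₀ → x 0 = x₀ →
        ∀ k : ℕ, 1 ≤ k →
          ‖d.A.adjoint (MajADMM.avgShift u k) + d.B.adjoint (MajADMM.avgShift v k) - d.c‖
              ≤ C₁ / k ∧
          MajADMM.IsApproxSolution P d (C₂ / k)
            (MajADMM.avgShift u k) (MajADMM.avgShift v k) (MajADMM.xHat d u v x k) ∧
          (d.CaseA ∨ (d.CaseB ∧ (d.S - d.η • d.D₁).IsPositive ∧ (d.T - d.η • d.D₂).IsPositive) →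
            ∀ (ub : U) (vb : V), MajADMM.IsSolution P d ub vb →
              P.θ (MajADMM.avgShift u k) (MajADMM.avgShift v k)
                  ≤ P.θ ub vb + ((C₃ / k : ℝ) : EReal) ∧
              P.θ ub vb
                  ≤ P.θ (MajADMM.avgShift u k) (MajADMM.avgShift v k) + ((C₃ / k : ℝ) : EReal)) := by
  open MajADMM in
  rcases Z.eq_empty_or_nonempty with hZ | ⟨z, hzZ⟩
  -- No admissible objective has an empty KKT set, so any constants do.
  · refine ⟨0, 0, 0, fun P hP ⟨u, v, hs⟩ hq hPZ => ?_⟩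
    have := kktSet_nonempty hP hs hq
    rw [hPZ, hZ] at this
    exact absurd this Set.not_nonempty_empty
  obtain ⟨C, G, hG, hdesc⟩ := exists_descent hd hcase u₀ v₀ x₀ z
  obtain ⟨K₁, K₂, hK⟩ := exists_uniform_bounds hd hG z C
  refine ⟨K₁, (K₂ + C) / 2, C / 2 + ‖z.2.2‖ * K₁, fun P hP _ _ hPZ u v x h hu hv hx k hk => ?_⟩
  have hz : z ∈ kktSet P d := hPZ ▸ hzZ
  have hk' : (0 : ℝ) < k := by exact_mod_cast hk
  obtain ⟨ξ, hξ, hC, hlin, hobj⟩ := hdesc P hP hz u v x h hu hv hx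
  obtain ⟨hzu, hzv, hkkt⟩ := kkt_inequality hP hz
  have hbd := fun k => (hlin z.1 hzu z.2.1 hzv z.2.2).bounded h hP hz k
  have hLG := lyapunov_nonneg hd hG (u 1) (v 1) (x 1) z.1 z.2.1 z.2.2
  have hCb : ∀ k, lyapunov d G (u (k + 1)) (v (k + 1)) (x (k + 1)) z.1 z.2.1 z.2.2 ≤ C := by
    intro j
    have := hbd j
    have := hξ j
    linarith
  obtain ⟨hres, hball⟩ := hK P u v x h hCb k hk
  have hau : avgShift u k ∈ dom P.p :=
    (average_le_of_convexOn hP.convexOn_pr (fun i _ => (h.mem_dom hP (i + 1)).1) hk).1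
  have hav : avgShift v k ∈ dom P.q :=
    (average_le_of_convexOn hP.convexOn_qr (fun i _ => (h.mem_dom hP (i + 1)).2) hk).1
  refine ⟨hres, isApproxSolution_of_gap hP hau hav fun u' hu' v' hv' x' hb => ?_,
    fun hex ub vb hs => ?_⟩
  · refine ((hlin u' hu' v' hv' x').ergodic h hd hP hG hξ (convexOn_linPart P _) hk).trans ?_
    rw [div_div]
    -- The bound `ξ 0 ≤ C` follows because the Lyapunov value in `hC` is nonnegative.
    have := hball u' v' x' hb
    gcongr
    linarith
  · obtain ⟨G', hG', hC', hD⟩ := hobj hex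
    have h1 := hD.ergodic h hd hP hG' hξ
      (hP.φ_smooth.convex.sub (concaveOn_const _ convex_univ)) hk
    have h2 : (lyapunov d G' (u 1) (v 1) (x 1) z.1 z.2.1 z.2.2 + ξ 0) / (2 * k) ≤ C / 2 / k := by
      rw [div_div]
      gcongr
    -- The lower estimate comes from the KKT inequality at the average, which costs only the
    -- multiplier times the residual.
    have h3 := hkkt _ hau _ hav
    have h4 := (linPart_le hP hd (pair z.1 z.2.1) (pair (avgShift u k) (avgShift v k))).2
    have h5 : |inner ℝ z.2.2 (d.res (avgShift u k) (avgShift v k))| ≤ ‖z.2.2‖ * K₁ / k := by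
      rw [mul_div_assoc]
      exact (abs_real_inner_le_norm _ _).trans (mul_le_mul_of_nonneg_left hres (norm_nonneg _))
    have h5' := abs_le.1 h5
    rw [gap, res_eq_zero_of_mem_kktSet hz, inner_zero_right] at h1
    rw [linPart] at h4
    have hC0 : 0 ≤ C / 2 / k := by
      have := hξ 0
      have : 0 ≤ C := by linarith
      positivity
    rw [hP.coe_θr hau hav, hP.coe_θr hs.mem_dom.1 hs.mem_dom.2, θr_eq_of_isSolution hP hd hz hs,
      ← EReal.coe_add, ← EReal.coe_add, EReal.coe_le_coe_iff, EReal.coe_le_coe_iff, add_div]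
    simp only [Objective.θr]
    constructor <;> linarith
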